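/- Fix integers $r\ge 1$ and $k\ge 1$. For every $n$ let $\Pi_n$ be a commutative group of permutations of $[n]$ such that $|\Pi_n|=O(n^\alpha)$ for some $\alpha$, such that, uniformly over the non-identity elements $\pi\in\Pi_n$, the number of cycles of $\pi$ of length at least two is $o(n/\log n)$ and the number of fixed points of $\pi$ is $o(n)$, and such that $\Pi_n$ is nontrivial for all large $n$. Let $P$ be a probability distribution on $[r]$ and let $W(\cdot\mid x)$, $x\in[r]$, be a channel from $[r]$ to $[r]^k$. The source image $\mathbf X\in[r]^n$ has i.i.d. pixels of law $P$; given $\mathbf X$, images $\tilde{\mathbf Y}^{(1)},\dots,\tilde{\mathbf Y}^{(k)}\in[r]^n$ are drawn with probability $\prod_{i=1}^n W(\tilde Y^{(1)}_i,\dots,\tilde Y^{(k)}_i\mid X_i)$; independently of these, $\pi_1,\dots,\pi_k$ are independent and uniform on $\Pi_n$. The observed images are $\mathbf X$ and $\mathbf Y^{(j)}$, where $Y^{(j)}_i=\tilde Y^{(j)}_{\pi_j(i)}$. For an image $\mathbf Y$ and a permutation $\sigma$ write $\mathbf Y_\sigma=(Y_{\sigma(i)})_{i\in[n]}$. A registration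 rule is a sequence of functions $\Phi^{(n)}$ of $(\mathbf X,\mathbf Y^{(1)},\dots,\mathbf Y^{(k)})$ with values $(\hat\pi_1,\dots,\hat\pi_k)\in\Pi_n^k$. Its error probability is $P_e(\Phi^{(n)})=\mathbb P[\hat\pi_j\ne\pi_j^{-1}\text{ for some }j]$, and its error exponent is $\mathcal E(\Phi)=\lim_{n\to\infty}-\frac1n\log P_e(\Phi^{(n)})$, if the limit exists. A max-multiinformation (MM) rule outputs a maximizer over $(\sigma_1,\dots,\sigma_k)\in\Pi_n^k$ of $\hat I_M(\mathbf X;\mathbf Y^{(1)}_{\sigma_1};\dots;\mathbf Y^{(k)}_{\sigma_k})$, where $\hat I_M$ is the multiinformation $I_M(X_1;\dots;X_m)=\sum_i H(X_i)-H(X_1,\dots,X_m)$ of the joint empirical distribution of the pixels. A maximum likelihood (ML) rule outputs a maximizer of $\prod_{i=1}^n W(Y^{(1)}_{\sigma_1(i)},\dots,Y^{(k)}_{\sigma_k(i)}\mid X_i)$. In both cases ties are broken arbitrarily. Theorem. The MM rule is universal (it is defined without knowledge of $P$ and $W$) and asymptotically optimal: for every MM rule $\Phi_{\mathrm{MM}}$,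 every $P$ and $W$, and every ML rule $\Phi_{\mathrm{ML}}$ for $W$, both error exponents exist as finite numbers and $$\mathcal E(\Phi_{\mathrm{MM}})=\mathcal E(\Phi_{\mathrm{ML}}),$$ and no registration rule, even one designed with knowledge of $P$ and $W$, does better in the exponent: $\limsup_{n\to\infty}-\frac1n\log P_e(\Psi^{(n)})\le\mathcal E(\Phi_{\mathrm{MM}})$ for every registration rule $\Psi$. The case $k=2$ is registration of three images. -/

import Mathlib

open Filter Topology Asymptotics

noncomputable section

namespace ImageRegistration

/-- An image with `n` pixels and pixel values in the finite set `[r]`. -/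
abbrev Image (n r : ℕ) : Type := Fin n → Fin r

/-- The image `x` transformed by the pixel permutation `π`: its `i`-th pixel is `x (π i)`. -/
def transform {n r : ℕ} (π : Equiv.Perm (Fin n)) (x : Image n r) : Image n r :=
  fun i => x (π i)

/-- The empirical distribution of a sequence of `n` symbols of a finite alphabet. -/
def empiricalDist {n : ℕ} {A : Type*} [DecidableEq A] (s : Fin n → A) (a : A) : ℝ :=
  ((Finset.univ.filter fun i => s i = a).card : ℝ) / n

/-- Shannon entropy (in nats) of a distribution on a finite alphabet. -/
def entropy {A : Type*} [Fintype A] (p : A → ℝ) : ℝ :=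
  ∑ a, Real.negMulLog (p a)

/-- The `j`-th marginal of a joint distribution. -/
def marginal {r m : ℕ} (q : (Fin m → Fin r) → ℝ) (j : Fin m) (a : Fin r) : ℝ :=
  ∑ v ∈ Finset.univ.filter (fun v : Fin m → Fin r => v j = a), q v

/-- The multiinformation `∑ⱼ H(Xⱼ) - H(X₁, …, Xₘ)` of a joint distribution. -/
def multiInformation {r m : ℕ} (q : (Fin m → Fin r) → ℝ) : ℝ :=
  ∑ j, entropy (marginal q j) - entropy q

/-- The multiinformation of the joint empirical distribution of `m` images. -/
def empiricalMultiInformation {n r m : ℕ} (z : Fin m → Image n r) : ℝ :=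
  multiInformation (empiricalDist fun (i : Fin n) (j : Fin m) => z j i)

/-- A rule for registering `k` images to a source image: from the source image and the `k`
received images it computes `k` permutations out of the set `G` of allowed ones. -/
abbrev Rule {n : ℕ} (r k : ℕ) (G : Subgroup (Equiv.Perm (Fin n))) : Type :=
  Image n r → (Fin k → Image n r) → (Fin k → G)

/-- The max-multiinformation rules: the output maximizes the empirical multiinformation of the
source image and the aligned images.  Ties may be broken in any way. -/
def IsMaxMultiInformation {n r k : ℕ} {G : Subgroup (Equiv.Perm (Fin n))}
    (Φ : Rule r k G) : Prop :=
  ∀ (x : Image n r) (y : Fin k → Image n r) (σ : Fin k → G),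
    empiricalMultiInformation
        (Fin.cons x (fun j => transform (σ j) (y j)) : Fin (k + 1) → Image n r) ≤
      empiricalMultiInformation
        (Fin.cons x (fun j => transform (Φ x y j) (y j)) : Fin (k + 1) → Image n r)

/-- The likelihood `∏ᵢ W(y₁ᵢ, …, yₖᵢ | xᵢ)` of (aligned) images `y` given the source `x`. -/
def likelihood {n r k : ℕ} (W : Fin r → (Fin k → Fin r) → ℝ)
    (x : Image n r) (y : Fin k → Image n r) : ℝ :=
  ∏ i, W (x i) (fun j => y j i)

/-- The maximum likelihood rules for the channel `W`.  Ties may be broken in any way. -/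
def IsMaxLikelihood {n r k : ℕ} {G : Subgroup (Equiv.Perm (Fin n))}
    (W : Fin r → (Fin k → Fin r) → ℝ) (Φ : Rule r k G) : Prop :=
  ∀ (x : Image n r) (y : Fin k → Image n r) (σ : Fin k → G),
    likelihood W x (fun j => transform (σ j) (y j)) ≤
      likelihood W x (fun j => transform (Φ x y j) (y j))

open Classical in
/-- The error probability of a rule.  The source image `x` has i.i.d. pixels of law `P`, the
noisy images `y` are the output of the memoryless channel `W` with input `x`, image `j` is
transformed by `π j`, the `π j` are independent and uniform on `G`, and there is an error unless
the rule returns the inverse of `π j` for every `j`. -/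
def errorProb {n r k : ℕ} {G : Subgroup (Equiv.Perm (Fin n))}
    (P : Fin r → ℝ) (W : Fin r → (Fin k → Fin r) → ℝ) (Φ : Rule r k G) : ℝ :=
  ∑ π : Fin k → G, ((Nat.card G : ℝ) ^ k)⁻¹ *
    ∑ x : Image n r, ∑ y : Fin k → Image n r,
      (∏ i, P (x i)) * likelihood W x y *
        (if Φ x (fun j => transform (π j) (y j)) = (fun j => (π j)⁻¹) then 0 else 1)

/-- `E` is the error exponent `lim -(1/n) log Pₑ(n)`; the error probabilities are required to be
eventually positive, so that the logarithm is a genuine one. -/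
def IsErrorExponent (Pe : ℕ → ℝ) (E : ℝ) : Prop :=
  (∀ᶠ n in atTop, 0 < Pe n) ∧
    Tendsto (fun n : ℕ => -(1 / (n : ℝ)) * Real.log (Pe n)) atTop (𝓝 E)

/-- The assumptions on the sets `G n` of allowed transformations of images with `n` pixels:
they are commutative permutation groups of polynomial size, and their non-identity elements have
`o(n / log n)` nontrivial cycles and `o(n)` fixed points (uniformly over `G n`).  The groups are
nontrivial for large `n`, as otherwise there is nothing to register. -/
structure Admissible (G : ∀ n : ℕ, Subgroup (Equiv.Perm (Fin n))) : Prop where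
  comm : ∀ n, ∀ π ∈ G n, ∀ π' ∈ G n, π * π' = π' * π
  card_le : ∃ α : ℝ, (fun n : ℕ => (Nat.card (G n) : ℝ)) =O[atTop] fun n : ℕ => (n : ℝ) ^ α
  cycles : ∀ ε : ℝ, 0 < ε → ∀ᶠ n : ℕ in atTop, ∀ π ∈ G n, π ≠ 1 →
    (Multiset.card π.cycleType : ℝ) ≤ ε * ((n : ℝ) / Real.log n)
  fixed : ∀ ε : ℝ, 0 < ε → ∀ᶠ n : ℕ in atTop, ∀ π ∈ G n, π ≠ 1 →
    ((Finset.univ.filter fun i => π i = i).card : ℝ) ≤ ε * (n : ℝ)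
  nontrivial : ∀ᶠ n : ℕ in atTop, ∃ π ∈ G n, π ≠ 1

end ImageRegistration

end

/-!
Let `Q` be the joint law of the `k + 1` values seen at a pixel. A registration error amounts to
confusing the images `z` with `realign τ z`, where `τ` moves the `j`-th component by a permutation
`τ j` of the group, `τ 0 = 1` and `τ ≠ 1`. For a nonempty set `B` of components without the source
let `lam B`
be the square of the largest singular value of the matrix `√Q`, with rows indexed by the values
of the components outside `B` and columns by the values of those in `B`
(`exists_top_singular`). With `lam` the largest of the numbers `lam B`, the common exponent is
`-log lam`.

*Lower bound for all rules.* Take `B` with `lam B = lam`, and let `τ` move the components in `B`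
by a nontrivial `g`. No rule can do better than half the overlap of the laws of `z` and
`realign τ z` (`half_overlap_le_errorProb`). The overlap is supermultiplicative over the cycles of
`g` (`overlap_mul_le`). For a cycle it is a sum over closed walks in a bipartite graph, of the
minimum of two products of edge weights, one for each orientation of the edges. Closed walks that
go out along one walk and come back along another one with the same end points and the same
numbers of traversals of each edge have equal products (`prod_glue_out`, `prod_glue_in`), and by the
Cauchy–Schwarz inequality they carry the full weight `lam B ^ l` up to a polynomial factor
(`pow_mul_le_cyclicOverlap`). As `g` has only `o(n / log n)` cycles, the polynomial factors, one for
each cycle, have no effect on the exponent.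

*Upper bound for maximum multiinformation rules.* Realigning does not change the marginals, so such
a rule errs only if some `realign τ z` has at most the joint empirical entropy of `z`. By the
union bound over the polynomially many `τ` it suffices to bound each of these probabilities by
`lam ^ n`, up to a factor of arbitrarily small exponential rate.
Since the group is commutative and its nontrivial elements have few fixed points and no small
order, there are a height function `t` on the pixels and a class `B` of components, all moved
by the same nontrivial element, such that at nearly every pixel `i` the permutations `(τ j)⁻¹` with
`j ∈ B` take `i` strictly higher than the others do (`exists_increasing_class`). The AM-GM inequality
bounds the probability of `z` by `lam B ^ n` times the empirical conditional probability of `z`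
given its components in `B` times that given its components outside `B`
(`prod_le_gain_mul_prod_condLaw`). By the entropy inequality the first of these factors may be
computed for `realign τ z` in place of `z`. The two factors then describe the image sequentially in
the order of `t`, so that their product sums to at most one for fixed empirical distributions
(`sum_kernel_le_one`, `sum_confused_le`), and there are polynomially many empirical distributions.

A maximum likelihood rule has the smallest error probability of all rules
(`IsMaxLikelihood.errorProb_le`), so its exponent is the same.
-/

set_option linter.unusedSectionVars false

namespace ImageRegistration

/-! ### Error probabilities as sums over candidate alignments -/

section Rules

variable {n r k : ℕ} {G : Subgroup (Equiv.Perm (Fin n))}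

/-- The images `y` transformed by the permutations `σ`, one for each image. -/
def align (σ : Fin k → G) (y : Fin k → Image n r) : Fin k → Image n r :=
  fun j => transform (σ j) (y j)

/-- The probability that the source image is `x` and the noisy images, before the random
transformations, are `y`. -/
noncomputable def jointWeight (P : Fin r → ℝ) (W : Fin r → (Fin k → Fin r) → ℝ)
    (x : Image n r) (y : Fin k → Image n r) : ℝ :=
  (∏ i, P (x i)) * likelihood W x y

lemma align_mul (σ τ : Fin k → G) (y : Fin k → Image n r) :
    align (σ * τ) y = align τ (align σ y) := by
  funext j i
  simp [align, transform]

lemma align_one (y : Fin k → Image n r) : align (1 : Fin k → G) y = y := by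
  funext j i
  simp [align, transform]

/-- Alignment by `σ`, as a permutation of the set of all `k`-tuples of images. -/
def alignEquiv (σ : Fin k → G) : (Fin k → Image n r) ≃ (Fin k → Image n r) where
  toFun := align σ
  invFun := align σ⁻¹
  left_inv y := by rw [← align_mul, mul_inv_cancel, align_one]
  right_inv y := by rw [← align_mul, inv_mul_cancel, align_one]

lemma sum_align (σ : Fin k → G) (f : (Fin k → Image n r) → ℝ) :
    ∑ y, f (align σ y) = ∑ y, f y :=
  Equiv.sum_comp (alignEquiv σ) f

open Classical in
/-- The error probability, computed by summing over the received images and over the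
alignment `σ` that undoes the random transformations. -/
lemma errorProb_eq (P : Fin r → ℝ) (W : Fin r → (Fin k → Fin r) → ℝ) (Φ : Rule r k G) :
    errorProb P W Φ = ((Nat.card G : ℝ) ^ k)⁻¹ *
      ∑ x : Image n r, ∑ y : Fin k → Image n r, ∑ σ : Fin k → G,
        jointWeight P W x (align σ y) * (if Φ x y = σ then 0 else 1) := by
  unfold errorProb
  rw [← Finset.mul_sum]
  congr 1
  have h : ∀ π : Fin k → G, (∑ x : Image n r, ∑ y : Fin k → Image n r,
      (∏ i, P (x i)) * likelihood W x y *
        (if Φ x (fun j => transform (π j) (y j)) = (fun j => (π j)⁻¹) then (0 : ℝ) else 1)) =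
      ∑ x : Image n r, ∑ y : Fin k → Image n r,
        jointWeight P W x (align π⁻¹ y) * (if Φ x y = π⁻¹ then 0 else 1) := by
    intro π
    refine Finset.sum_congr rfl fun x _ => ?_
    rw [← sum_align π (fun y => jointWeight P W x (align π⁻¹ y) *
      (if Φ x y = π⁻¹ then (0 : ℝ) else 1))]
    refine Finset.sum_congr rfl fun y _ => ?_
    rw [← align_mul, mul_inv_cancel, align_one]
    rfl
  rw [Finset.sum_congr rfl fun π _ => h π]
  refine (Equiv.sum_comp (Equiv.inv (Fin k → G)) (fun σ => ∑ x : Image n r,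
    ∑ y : Fin k → Image n r,
        jointWeight P W x (align σ y) * (if Φ x y = σ then (0 : ℝ) else 1))).trans ?_
  rw [Finset.sum_comm]
  refine Finset.sum_congr rfl fun x _ => ?_
  rw [Finset.sum_comm]

lemma jointWeight_nonneg {P : Fin r → ℝ} {W : Fin r → (Fin k → Fin r) → ℝ}
    (hP : ∀ a, 0 ≤ P a) (hW : ∀ a v, 0 ≤ W a v) (x : Image n r) (y : Fin k → Image n r) :
    0 ≤ jointWeight P W x y :=
  mul_nonneg (Finset.prod_nonneg fun _ _ => hP _) (Finset.prod_nonneg fun _ _ => hW _ _)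

open Classical in
lemma card_pi_subgroup : (Fintype.card (Fin k → G) : ℝ) = (Nat.card G : ℝ) ^ k := by
  rw [← Nat.card_eq_fintype_card]; simp

lemma card_pow_pos : (0 : ℝ) < (Nat.card G : ℝ) ^ k := by
  have : 0 < Nat.card G := Nat.card_pos
  positivity

/-- No rule can tell two candidate alignments apart: whatever it answers, for every nontrivial
relative misalignment `τ` it errs with at least half the overlap of the two hypotheses. -/
lemma half_overlap_le_errorProb {P : Fin r → ℝ} {W : Fin r → (Fin k → Fin r) → ℝ}
    (hP : ∀ a, 0 ≤ P a) (hW : ∀ a v, 0 ≤ W a v) (Φ : Rule r k G)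
    {τ : Fin k → G} (hτ : τ ≠ 1) :
    (1 / 2) * ∑ x : Image n r, ∑ y : Fin k → Image n r,
      min (jointWeight P W x y) (jointWeight P W x (align τ y)) ≤ errorProb P W Φ := by
  classical
  rw [errorProb_eq, inv_mul_eq_div, le_div_iff₀ card_pow_pos, ← card_pi_subgroup]
  have key : ∀ (x : Image n r) (y : Fin k → Image n r),
      ∑ σ : Fin k → G, min (jointWeight P W x (align σ y))
        (jointWeight P W x (align τ (align σ y))) ≤
      2 * ∑ σ : Fin k → G, jointWeight P W x (align σ y) *
        (if Φ x y = σ then (0 : ℝ) else 1) := by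
    intro x y
    set F : (Fin k → G) → ℝ := fun σ => jointWeight P W x (align σ y) *
        (if Φ x y = σ then (0 : ℝ) else 1) with hF
    have h2 : ∑ σ, F (σ * τ) = ∑ σ, F σ := Equiv.sum_comp (Equiv.mulRight τ) F
    calc _ ≤ ∑ σ : Fin k → G, (F σ + F (σ * τ)) := by
          refine Finset.sum_le_sum fun σ _ => ?_
          have h0 := jointWeight_nonneg hP hW x (align σ y)
          have h1 := jointWeight_nonneg hP hW x (align (σ * τ) y)
          simp only [hF]
          rw [← align_mul]
          by_cases h : Φ x y = σ
          · simp [h, hτ]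
          · simp only [h, if_false, mul_one]
            refine (min_le_left _ _).trans (le_add_of_nonneg_right ?_)
            split_ifs <;> simp [h1]
      _ = _ := by rw [Finset.sum_add_distrib, h2]; ring
  have hsum : (Fintype.card (Fin k → G) : ℝ) * ∑ x : Image n r, ∑ y : Fin k → Image n r,
      min (jointWeight P W x y) (jointWeight P W x (align τ y)) =
      ∑ x : Image n r, ∑ y : Fin k → Image n r, ∑ σ : Fin k → G,
        min (jointWeight P W x (align σ y)) (jointWeight P W x (align τ (align σ y))) := by
    rw [Finset.mul_sum]
    refine Finset.sum_congr rfl fun x _ => ?_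
    rw [Finset.sum_comm, Finset.sum_congr rfl fun σ _ => sum_align σ
      (fun y => min (jointWeight P W x y) (jointWeight P W x (align τ y)))]
    simp
  have := Finset.sum_le_sum (s := Finset.univ) fun x (_ : x ∈ Finset.univ) =>
    Finset.sum_le_sum (s := Finset.univ) fun y (_ : y ∈ Finset.univ) => key x y
  rw [← hsum] at this
  simp only [← Finset.mul_sum] at this
  linarith

/-- A maximum likelihood rule minimizes the error probability. -/
lemma IsMaxLikelihood.errorProb_le {P : Fin r → ℝ} {W : Fin r → (Fin k → Fin r) → ℝ}
    (hP : ∀ a, 0 ≤ P a) {Φ : Rule r k G} (hΦ : IsMaxLikelihood W Φ) (Ψ : Rule r k G) :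
    errorProb P W Φ ≤ errorProb P W Ψ := by
  classical
  rw [errorProb_eq, errorProb_eq]
  refine mul_le_mul_of_nonneg_left ?_ (inv_nonneg.mpr card_pow_pos.le)
  refine Finset.sum_le_sum fun x _ => Finset.sum_le_sum fun y _ => ?_
  have h : ∀ Θ : Rule r k G, ∑ σ : Fin k → G, jointWeight P W x (align σ y) *
      (if Θ x y = σ then (0 : ℝ) else 1) =
      ∑ σ : Fin k → G, jointWeight P W x (align σ y) - jointWeight P W x (align (Θ x y) y) := by
    intro Θ
    rw [eq_sub_iff_add_eq]
    have : jointWeight P W x (align (Θ x y) y) = ∑ σ : Fin k → G,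
        if Θ x y = σ then jointWeight P W x (align σ y) else 0 := by simp
    rw [this, ← Finset.sum_add_distrib]
    refine Finset.sum_congr rfl fun σ _ => ?_
    split_ifs <;> simp
  rw [h, h]
  refine sub_le_sub_left ?_ _
  exact mul_le_mul_of_nonneg_left (hΦ x y (Ψ x y)) (Finset.prod_nonneg fun _ _ => hP _)

open Classical in
/-- Union bound for max-multiinformation rules over the relative misalignments `τ`. -/
lemma IsMaxMultiInformation.errorProb_le {P : Fin r → ℝ} {W : Fin r → (Fin k → Fin r) → ℝ}
    (hP : ∀ a, 0 ≤ P a) (hW : ∀ a v, 0 ≤ W a v) {Φ : Rule r k G}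
    (hΦ : IsMaxMultiInformation Φ) :
    errorProb P W Φ ≤ ∑ τ ∈ Finset.univ.filter (fun τ : Fin k → G => τ ≠ 1),
      ∑ x : Image n r, ∑ y : Fin k → Image n r, jointWeight P W x y *
        (if empiricalMultiInformation (Fin.cons x y : Fin (k + 1) → Image n r) ≤
          empiricalMultiInformation (Fin.cons x (align τ y) : Fin (k + 1) → Image n r)
          then 1 else 0) := by
  rw [errorProb_eq, inv_mul_eq_div, div_le_iff₀ card_pow_pos, ← card_pi_subgroup]
  set F : (Fin k → G) → Image n r → (Fin k → Image n r) → ℝ := fun τ x y =>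
    jointWeight P W x y *
        (if empiricalMultiInformation (Fin.cons x y : Fin (k + 1) → Image n r) ≤
          empiricalMultiInformation (Fin.cons x (align τ y) : Fin (k + 1) → Image n r)
          then 1 else 0) with hF
  have hF0 : ∀ τ x y, 0 ≤ F τ x y := by
    intro τ x y
    refine mul_nonneg (jointWeight_nonneg hP hW x y) ?_
    split_ifs <;> simp
  have key : ∀ (x : Image n r) (y : Fin k → Image n r) (σ : Fin k → G),
      jointWeight P W x (align σ y) * (if Φ x y = σ then (0 : ℝ) else 1) ≤
      ∑ τ ∈ Finset.univ.filter (fun τ : Fin k → G => τ ≠ 1), F τ x (align σ y) := by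
    intro x y σ
    by_cases h : Φ x y = σ
    · simp only [h, if_true, mul_zero]
      exact Finset.sum_nonneg fun τ _ => hF0 _ _ _
    · have hmem : σ⁻¹ * Φ x y ∈ Finset.univ.filter (fun τ : Fin k → G => τ ≠ 1) := by
        simp only [Finset.mem_filter, Finset.mem_univ, true_and]
        intro h'
        exact h (inv_mul_eq_one.mp h').symm
      refine le_trans (le_of_eq ?_) (Finset.single_le_sum (fun τ _ => hF0 τ x (align σ y)) hmem)
      have := hΦ x y σ
      simp only [hF, h, if_false]
      rw [← align_mul, mul_inv_cancel_left]
      exact congrArg _ (if_pos this).symm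
  calc _ ≤ ∑ x : Image n r, ∑ y : Fin k → Image n r, ∑ σ : Fin k → G,
        ∑ τ ∈ Finset.univ.filter (fun τ : Fin k → G => τ ≠ 1), F τ x (align σ y) :=
        Finset.sum_le_sum fun x _ => Finset.sum_le_sum fun y _ =>
          Finset.sum_le_sum fun σ _ => key x y σ
    _ = ∑ x : Image n r, ∑ σ : Fin k → G, ∑ y : Fin k → Image n r,
        ∑ τ ∈ Finset.univ.filter (fun τ : Fin k → G => τ ≠ 1), F τ x y := by
        refine Finset.sum_congr rfl fun x _ => ?_
        rw [Finset.sum_comm]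
        exact Finset.sum_congr rfl fun σ _ => sum_align σ (fun y => ∑ τ ∈ _, F τ x y)
    _ = _ := by
        have h1 : ∀ x : Image n r, ∑ y : Fin k → Image n r,
            ∑ τ ∈ Finset.univ.filter (fun τ : Fin k → G => τ ≠ 1), F τ x y =
            ∑ τ ∈ Finset.univ.filter (fun τ : Fin k → G => τ ≠ 1), ∑ y, F τ x y :=
          fun x => Finset.sum_comm
        simp only [Finset.sum_const, Finset.card_univ, nsmul_eq_mul, h1]
        rw [← Finset.mul_sum, mul_comm, Finset.sum_comm]

/-- The law of the `k + 1` values observed at one pixel: the source and its noisy versions. -/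
def pixelLaw (P : Fin r → ℝ) (W : Fin r → (Fin k → Fin r) → ℝ) (a : Fin (k + 1) → Fin r) : ℝ :=
  P (a 0) * W (a 0) (fun j => a j.succ)

/-- The source image and the noisy images as one image with vector-valued pixels. -/
def stack (x : Image n r) (y : Fin k → Image n r) (i : Fin n) : Fin (k + 1) → Fin r :=
  Fin.cons (x i) (fun j => y j i)

lemma jointWeight_eq_prod (P : Fin r → ℝ) (W : Fin r → (Fin k → Fin r) → ℝ)
    (x : Image n r) (y : Fin k → Image n r) :
    jointWeight P W x y = ∏ i, pixelLaw P W (stack x y i) := by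
  simp [jointWeight, likelihood, pixelLaw, stack, Finset.prod_mul_distrib]

lemma pixelLaw_nonneg {P : Fin r → ℝ} {W : Fin r → (Fin k → Fin r) → ℝ}
    (hP : ∀ a, 0 ≤ P a) (hW : ∀ a v, 0 ≤ W a v) (a : Fin (k + 1) → Fin r) :
    0 ≤ pixelLaw P W a := mul_nonneg (hP _) (hW _ _)

lemma sum_pixelLaw {P : Fin r → ℝ} {W : Fin r → (Fin k → Fin r) → ℝ}
    (hP : ∑ a, P a = 1) (hW : ∀ a, ∑ v, W a v = 1) : ∑ a, pixelLaw P W a = 1 := by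
  rw [← Equiv.sum_comp (Fin.consEquiv fun _ : Fin (k + 1) => Fin r), Fintype.sum_prod_type]
  simp [pixelLaw, Fin.consEquiv, ← Finset.mul_sum, hW, hP]

/-- Sums over the source image and the noisy images are sums over the stacked image. -/
lemma sum_stack (F : (Fin n → Fin (k + 1) → Fin r) → ℝ) :
    ∑ x : Image n r, ∑ y : Fin k → Image n r, F (stack x y) = ∑ z, F z := by
  rw [← Fintype.sum_prod_type' (f := fun x y => F (stack x y))]
  refine Fintype.sum_equiv ⟨fun p => stack p.1 p.2, fun z => (fun i => z i 0,
    fun j i => z i j.succ), fun p => ?_, fun z => ?_⟩ _ _ fun p => rfl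
  · rfl
  · funext i
    exact Fin.cons_self_tail (z i)

end Rules

/-! ### Almost everywhere increasing orders for commuting permutations -/

section Order

variable {J : Type}

lemma abs_single_sub_single_le [DecidableEq J] (j l i : J) :
    |(Pi.single j 1 - Pi.single l 1 : J → ℤ) i| ≤ 1 := by
  simp only [Pi.sub_apply, Pi.single_apply]
  split_ifs <;> simp

lemma exists_nsmul_mem_closure (Λ : Set (J → ℤ)) (v : J → ℚ)
    (hv : v ∈ Submodule.span ℚ ((fun u : J → ℤ => fun j => (u j : ℚ)) '' Λ)) :
    ∃ c : ℕ, 0 < c ∧ ∃ w ∈ AddSubgroup.closure Λ, ∀ j, (c : ℚ) * v j = (w j : ℚ) := by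
  induction hv using Submodule.span_induction with
  | mem x hx =>
    obtain ⟨u, hu, rfl⟩ := hx
    exact ⟨1, one_pos, u, AddSubgroup.subset_closure hu, fun j => by simp⟩
  | zero => exact ⟨1, one_pos, 0, zero_mem _, fun j => by simp⟩
  | add x y _ _ hx hy =>
    obtain ⟨c, hc, w, hw, h⟩ := hx
    obtain ⟨d, hd, w', hw', h'⟩ := hy
    refine ⟨c * d, Nat.mul_pos hc hd, d • w + c • w', add_mem (nsmul_mem hw _) (nsmul_mem hw' _),
      fun j => ?_⟩
    have h1 : (d • w + c • w') j = d * w j + c * w' j := by simp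
    rw [h1, Pi.add_apply]
    push_cast
    rw [← h, ← h']
    ring
  | smul q x _ hx =>
    obtain ⟨c, hc, w, hw, h⟩ := hx
    refine ⟨q.den * c, Nat.mul_pos q.den_pos hc, q.num • w, zsmul_mem hw _, fun j => ?_⟩
    simp only [Pi.smul_apply, smul_eq_mul, Int.cast_mul, Nat.cast_mul, ← h]
    have := Rat.den_mul_eq_num q
    linear_combination (c : ℚ) * x j * this

/-- The product `∏ⱼ ρⱼ ^ uⱼ`. -/
def word [Fintype J] {H : Type} [CommGroup H] (ρ : J → H) (u : J → ℤ) : H := ∏ j, ρ j ^ u j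

lemma word_add [Fintype J] {H : Type} [CommGroup H] (ρ : J → H) (u v : J → ℤ) :
    word ρ (u + v) = word ρ u * word ρ v := by
  simp [word, zpow_add, Finset.prod_mul_distrib]

lemma word_sub [Fintype J] {H : Type} [CommGroup H] (ρ : J → H) (u v : J → ℤ) :
    word ρ (u - v) = word ρ u / word ρ v := by
  simp [word, zpow_sub, Finset.prod_mul_distrib, div_eq_mul_inv]

lemma word_nsmul [Fintype J] {H : Type} [CommGroup H] (ρ : J → H) (c : ℕ) (u : J → ℤ) :
    word ρ (c • u) = word ρ u ^ c := by
  simp [word, mul_comm (c : ℤ), zpow_mul, Finset.prod_pow]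

lemma word_zero [Fintype J] {H : Type} [CommGroup H] (ρ : J → H) : word ρ 0 = 1 := by simp [word]

variable [Fintype J] [DecidableEq J] {H : Type} [CommGroup H]

/-- The integer vectors with all coordinates of absolute value at most `M`. -/
noncomputable def box (J : Type) [Fintype J] [DecidableEq J] (M : ℕ) : Finset (J → ℤ) :=
  Fintype.piFinset fun _ => Finset.Icc (-(M : ℤ)) M

lemma mem_box {M : ℕ} {u : J → ℤ} : u ∈ box J M ↔ ∀ j, |u j| ≤ M := by
  simp [box, abs_le]

lemma card_box (M : ℕ) : (box J M).card = (2 * M + 1) ^ Fintype.card J := by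
  have : ((M : ℤ) + 1 + M).toNat = 2 * M + 1 := by omega
  simp [box, Fintype.card_piFinset, this]

/-- If a difference of basis vectors is a rational combination of vectors of a finite box, then
a positive multiple of it is an integral combination of them, and the multiplier can be bounded
in terms of the box only. -/
lemma exists_torsion_bound (M : ℕ) : ∃ D : ℕ, ∀ Λ ⊆ box J M, ∀ j l : J,
    ((fun i => ((Pi.single j 1 - Pi.single l 1 : J → ℤ) i : ℚ)) : J → ℚ) ∈
      Submodule.span ℚ ((fun u : J → ℤ => fun j => (u j : ℚ)) '' (Λ : Set (J → ℤ))) →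
    ∃ c : ℕ, 0 < c ∧ c ≤ D ∧
      c • (Pi.single j 1 - Pi.single l 1 : J → ℤ) ∈ AddSubgroup.closure (Λ : Set (J → ℤ)) := by
  have h : ∀ p : Finset (J → ℤ) × J × J, ∃ c : ℕ,
      ((fun i => ((Pi.single p.2.1 1 - Pi.single p.2.2 1 : J → ℤ) i : ℚ)) : J → ℚ) ∈
      Submodule.span ℚ ((fun u : J → ℤ => fun j => (u j : ℚ)) '' (p.1 : Set (J → ℤ))) →
      0 < c ∧ c • (Pi.single p.2.1 1 - Pi.single p.2.2 1 : J → ℤ) ∈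
        AddSubgroup.closure (p.1 : Set (J → ℤ)) := by
    intro p
    by_cases hp : ((fun i => ((Pi.single p.2.1 1 - Pi.single p.2.2 1 : J → ℤ) i : ℚ)) : J → ℚ) ∈
      Submodule.span ℚ ((fun u : J → ℤ => fun j => (u j : ℚ)) '' (p.1 : Set (J → ℤ)))
    · obtain ⟨c, hc, w, hw, h⟩ := exists_nsmul_mem_closure _ _ hp
      refine ⟨c, fun _ => ⟨hc, ?_⟩⟩
      convert hw using 1
      funext i
      have := h i
      rw [Pi.smul_apply, nsmul_eq_mul]
      exact_mod_cast this
    · exact ⟨0, fun h => absurd h hp⟩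
  choose c hc using h
  obtain ⟨D, hD⟩ : ∃ D, ∀ p ∈ (box J M).powerset ×ˢ (Finset.univ : Finset (J × J)), c p ≤ D :=
    ⟨_, fun p hp => Finset.le_sup hp⟩
  refine ⟨D, fun Λ hΛ j l hmem => ⟨c (Λ, j, l), (hc (Λ, j, l) hmem).1, hD _ ?_,
    (hc (Λ, j, l) hmem).2⟩⟩
  exact Finset.mem_product.mpr ⟨Finset.mem_powerset.mpr hΛ, Finset.mem_univ _⟩

lemma word_single (ρ : J → H) (j : J) : word ρ (Pi.single j 1) = ρ j := by
  rw [word, Finset.prod_eq_single j]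
  · simp
  · intro i _ hi; simp [hi]
  · simp

lemma word_eq_one_of_mem_closure (ρ : J → H) {Λ : Set (J → ℤ)} (hΛ : ∀ u ∈ Λ, word ρ u = 1)
    {u : J → ℤ} (hu : u ∈ AddSubgroup.closure Λ) : word ρ u = 1 := by
  induction hu using AddSubgroup.closure_induction with
  | mem x hx => exact hΛ x hx
  | zero => exact word_zero ρ
  | add x y _ _ hx hy => rw [word_add, hx, hy, one_mul]
  | neg x _ hx => rw [← zero_sub, word_sub, hx, word_zero, div_one]

/-- A linear functional that respects all short relations among the `ρⱼ` and separates the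
different `ρⱼ`.  It exists unless some quotient of two of them has small order. -/
lemma exists_separating_functional (J : Type) [Fintype J] [DecidableEq J] (M : ℕ) : ∃ D : ℕ,
    ∀ {H : Type} [CommGroup H] (ρ : J → H),
    (∀ j l, ρ j ≠ ρ l → ∀ c : ℕ, 0 < c → c ≤ D → (ρ j / ρ l) ^ c ≠ 1) →
    ∃ θ : J → ℚ, (∀ u ∈ box J M, word ρ u = 1 → ∑ j, (u j : ℚ) * θ j = 0) ∧
      ∀ j l, ρ j ≠ ρ l → θ j ≠ θ l := by
  classical
  obtain ⟨D, hD⟩ := exists_torsion_bound (J := J) M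
  refine ⟨D, fun {H} _ ρ hρ => ?_⟩
  set Λ : Finset (J → ℤ) := (box J M).filter fun u => word ρ u = 1 with hΛ
  let N : Submodule ℚ (J → ℚ) :=
    { carrier := {θ | ∀ u ∈ Λ, ∑ j, (u j : ℚ) * θ j = 0}
      add_mem' := fun {a b} ha hb u hu => by
        simp [mul_add, Finset.sum_add_distrib, ha u hu, hb u hu]
      zero_mem' := fun u _ => by simp
      smul_mem' := fun c a ha u hu => by
        have := ha u hu
        simp only [Pi.smul_apply, smul_eq_mul, mul_left_comm _ c, ← Finset.mul_sum, this, mul_zero] }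
  let E : J × J → Submodule ℚ N := fun p =>
    LinearMap.ker (((LinearMap.proj p.1 : (J → ℚ) →ₗ[ℚ] ℚ) - LinearMap.proj p.2) ∘ₗ N.subtype)
  let S : Finset (Submodule ℚ N) := (Finset.univ.filter fun p : J × J => ρ p.1 ≠ ρ p.2).image E
  have htop : ⊤ ∉ S := by
    intro h
    obtain ⟨p, hp, hpE⟩ := Finset.mem_image.mp h
    have hne : ρ p.1 ≠ ρ p.2 := (Finset.mem_filter.mp hp).2
    have hnot : ((fun i => ((Pi.single p.1 1 - Pi.single p.2 1 : J → ℤ) i : ℚ)) : J → ℚ) ∉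
      Submodule.span ℚ ((fun u : J → ℤ => fun j => (u j : ℚ)) '' (Λ : Set (J → ℤ))) := by
      intro hmem
      obtain ⟨c, hc, hcD, hcl⟩ := hD Λ (Finset.filter_subset _ _) p.1 p.2 hmem
      have := word_eq_one_of_mem_closure ρ (fun u hu => (Finset.mem_filter.mp hu).2) hcl
      rw [word_nsmul, word_sub, word_single, word_single] at this
      exact hρ _ _ hne c hc hcD this
    obtain ⟨f, hf, hker⟩ := Submodule.exists_le_ker_of_notMem hnot
    have hfsum : ∀ v : J → ℚ, f v = ∑ i, v i * f (Pi.single i 1) := by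
      intro v
      have hv : v = ∑ i, v i • (Pi.single i 1 : J → ℚ) := by
        funext j
        simp [Pi.single_apply]
      conv_lhs => rw [hv]
      simp only [map_sum, map_smul, smul_eq_mul]
    have hN : (fun i => f (Pi.single i 1)) ∈ N := by
      intro u hu
      rw [← hfsum (fun j => (u j : ℚ))]
      exact hker (Submodule.subset_span ⟨u, hu, rfl⟩)
    have hE : (⟨_, hN⟩ : N) ∈ E p := by rw [hpE]; trivial
    apply hf
    have h1 : f (Pi.single p.1 1) - f (Pi.single p.2 1) = 0 := by
      simpa [E, LinearMap.mem_ker] using hE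
    rw [← map_sub] at h1
    rw [← h1]
    congr 1
    funext i
    simp [Pi.single_apply]
  -- a vector space over `ℚ` is not a finite union of proper subspaces
  have hcov := Subspace.biUnion_ne_univ_of_top_notMem htop
  obtain ⟨θ, hθ⟩ := (Set.ne_univ_iff_exists_notMem _).mp hcov
  refine ⟨θ.1, fun u hu hw => θ.2 u (Finset.mem_filter.mpr ⟨hu, hw⟩), fun j l hjl heq => hθ ?_⟩
  refine Set.mem_biUnion (x := E (j, l)) ?_ ?_
  · exact Finset.mem_coe.mpr (Finset.mem_image_of_mem _ (by simp [hjl]))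
  · show θ ∈ E (j, l)
    simp [E, LinearMap.mem_ker, heq]

variable {X : Type} [MulAction H X] [DecidableEq X]

/-- The points reached from `s` by words with exponents at most `R`. -/
noncomputable def wordBall (ρ : J → H) (s : X) (R : ℕ) : Finset X :=
  (box J R).image fun u => word ρ u • s

lemma self_mem_wordBall (ρ : J → H) (s : X) (R : ℕ) : s ∈ wordBall ρ s R :=
  Finset.mem_image.mpr ⟨0, by simp [mem_box], by simp [word_zero]⟩

lemma card_wordBall_le (ρ : J → H) (s : X) (R : ℕ) :
    (wordBall ρ s R).card ≤ (2 * R + 1) ^ Fintype.card J :=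
  Finset.card_image_le.trans_eq (card_box R)

lemma wordBall_mono (ρ : J → H) (s : X) {R R' : ℕ} (h : R ≤ R') :
    wordBall ρ s R ⊆ wordBall ρ s R' := by
  refine Finset.image_subset_image fun u hu => ?_
  rw [mem_box] at hu ⊢
  exact fun j => (hu j).trans (by exact_mod_cast h)

lemma div_smul_mem_wordBall (ρ : J → H) {s p : X} {R : ℕ} (hp : p ∈ wordBall ρ s R) (j l : J) :
    (ρ j / ρ l) • p ∈ wordBall ρ s (R + 1) := by
  obtain ⟨u, hu, rfl⟩ := Finset.mem_image.mp hp
  refine Finset.mem_image.mpr ⟨(Pi.single j 1 - Pi.single l 1) + u, ?_, ?_⟩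
  · rw [mem_box] at hu ⊢
    intro i
    have h1 := abs_single_sub_single_le j l i
    have := abs_add_le ((Pi.single j 1 - Pi.single l 1 : J → ℤ) i) (u i)
    have := hu i
    rw [Pi.add_apply]
    push_cast
    linarith
  · rw [word_add, word_sub, word_single, word_single, mul_smul]

lemma sub_sub_mem_box {R T : ℕ} {u v : J → ℤ} (hu : u ∈ box J R) (hv : v ∈ box J R)
    (hRT : R < T) (j l : J) : v - u - (Pi.single j 1 - Pi.single l 1) ∈ box J (2 * T) := by
  rw [mem_box] at *
  intro i
  have h1 := abs_single_sub_single_le j l i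
  have h2 := hu i
  have h3 := hv i
  rw [Pi.sub_apply, Pi.sub_apply v u]
  generalize (Pi.single j 1 - Pi.single l 1 : J → ℤ) i = e at *
  rw [abs_le] at *
  push_cast
  omega

lemma word_sub_sub_smul (ρ : J → H) {u v : J → ℤ} {s p : X} {j l : J} (hu : word ρ u • s = p)
    (hv : word ρ v • s = (ρ j / ρ l) • p) :
    word ρ (v - u - (Pi.single j 1 - Pi.single l 1)) • s = s := by
  have h : word ρ (v - u - (Pi.single j 1 - Pi.single l 1)) =
      ((ρ j / ρ l) * word ρ u)⁻¹ * word ρ v := by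
    rw [word_sub, word_sub, word_sub, word_single, word_single, mul_inv_rev, div_eq_mul_inv,
      div_eq_mul_inv (word ρ v)]
    simp only [mul_comm, mul_left_comm]
  rw [h, mul_smul, hv, ← hu, ← mul_smul (ρ j / ρ l), inv_smul_smul]

/-- Balls grow polynomially, hence some ball of bounded radius has a relatively small shell. -/
lemma exists_small_shell (ρ : J → H) {U : Finset X} {s : X} (hs : s ∈ U) {δ : ℝ} (hδ : 0 < δ)
    {T : ℕ} (hT : ((2 * T + 1 : ℕ) : ℝ) ^ Fintype.card J < (1 + δ) ^ T) :
    ∃ R < T, ((U ∩ wordBall ρ s (R + 1)).card : ℝ) ≤ (1 + δ) * (U ∩ wordBall ρ s R).card := by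
  by_contra! hcon
  have h : ∀ R ≤ T, (1 + δ) ^ R ≤ ((U ∩ wordBall ρ s R).card : ℝ) := by
    intro R
    induction R with
    | zero =>
      intro _
      rw [pow_zero, Nat.one_le_cast, Nat.one_le_iff_ne_zero, Finset.card_ne_zero]
      exact ⟨s, Finset.mem_inter.mpr ⟨hs, self_mem_wordBall ρ s 0⟩⟩
    | succ R ih =>
      intro hR
      have h1 := ih (by omega)
      have h2 := hcon R (by omega)
      rw [pow_succ']
      have : 0 < 1 + δ := by linarith
      nlinarith
  have h1 := h T le_rfl
  have h2 : ((U ∩ wordBall ρ s T).card : ℝ) ≤ ((2 * T + 1 : ℕ) : ℝ) ^ Fintype.card J := by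
    exact_mod_cast (Finset.card_le_card Finset.inter_subset_right).trans (card_wordBall_le ρ s T)
  linarith

lemma sum_sub_sub_mul (θ : J → ℚ) (u v : J → ℤ) (j l : J) :
    ∑ i, ((v - u - (Pi.single j 1 - Pi.single l 1) : J → ℤ) i : ℚ) * θ i =
      ∑ i, (v i : ℚ) * θ i - ∑ i, (u i : ℚ) * θ i - (θ j - θ l) := by
  simp [Pi.single_apply, sub_mul, Finset.sum_sub_distrib]

/-- The functional `θ` integrates to a height function outside a small set: the space is cut
into cells, each a ball from which the earlier cells and their shells have been removed, and on a
cell around `s` the height of `word ρ u • s` is `θ u`.  The exceptional set consists of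
the shells and of the points that are fixed by a short word on which `θ` does not vanish. -/
lemma exists_height (ρ : J → H) (θ : J → ℚ) {δ : ℝ} (hδ : 0 < δ)
    {T : ℕ} (hT : ((2 * T + 1 : ℕ) : ℝ) ^ Fintype.card J < (1 + δ) ^ T) (Exc : Finset X)
    (hExc : ∀ s ∉ Exc, ∀ u ∈ box J (2 * T), word ρ u • s = s → ∑ j, (u j : ℚ) * θ j = 0)
    (U : Finset X) :
    ∃ Sh ⊆ U, (Sh.card : ℝ) ≤ δ * U.card + (U ∩ Exc).card ∧ ∃ t : X → ℚ,
      ∀ p ∈ U \ Sh, ∀ j l, (ρ j / ρ l) • p ∈ U \ Sh → t ((ρ j / ρ l) • p) = t p + θ j - θ l := by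
  classical
  induction U using Finset.strongInduction with
  | H U ih =>
  by_cases hU : U ⊆ Exc
  · refine ⟨U, subset_rfl, ?_, 0, by simp⟩
    rw [Finset.inter_eq_left.mpr hU]
    have : 0 ≤ δ * U.card := by positivity
    linarith
  obtain ⟨s, hsU, hsE⟩ := Finset.not_subset.mp hU
  obtain ⟨R, hRT, hR⟩ := exists_small_shell ρ hsU hδ hT
  set C := wordBall ρ s R with hC
  set C' := wordBall ρ s (R + 1) with hC'
  have hCC' : C ⊆ C' := wordBall_mono ρ s (Nat.le_succ R)
  have hlt : U \ C' ⊂ U := by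
    refine Finset.ssubset_iff_subset_ne.mpr ⟨Finset.sdiff_subset, fun h => ?_⟩
    rw [← h] at hsU
    exact (Finset.mem_sdiff.mp hsU).2 (self_mem_wordBall ρ s (R + 1))
  obtain ⟨Sh, hShU, hcard, t, ht⟩ := ih _ hlt
  have hrep : ∀ p : X, ∃ u : J → ℤ, p ∈ C → u ∈ box J R ∧ word ρ u • s = p := by
    intro p
    by_cases hp : p ∈ C
    · obtain ⟨u, hu⟩ := Finset.mem_image.mp hp
      exact ⟨u, fun _ => hu⟩
    · exact ⟨0, fun h => absurd h hp⟩
  choose w hw using hrep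
  refine ⟨Sh ∪ ((U ∩ C') \ C), ?_, ?_, fun p => if p ∈ C then ∑ j, (w p j : ℚ) * θ j else t p, ?_⟩
  · refine Finset.union_subset (hShU.trans Finset.sdiff_subset) ?_
    exact Finset.sdiff_subset.trans Finset.inter_subset_left
  · have h1 : (Sh ∪ ((U ∩ C') \ C)).card ≤ Sh.card + ((U ∩ C') \ C).card := Finset.card_union_le _ _
    have h2 : ((U ∩ C') \ C).card + (U ∩ C).card = (U ∩ C').card := by
      rw [← Finset.card_sdiff_add_card_inter (U ∩ C') C, Finset.inter_assoc,
        Finset.inter_eq_right.mpr hCC']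
    have h3 : (U \ C').card + (U ∩ C').card = U.card := Finset.card_sdiff_add_card_inter U C'
    have h4 : ((U \ C') ∩ Exc).card ≤ (U ∩ Exc).card :=
      Finset.card_le_card (Finset.inter_subset_inter_right Finset.sdiff_subset)
    have h5 : (U ∩ C).card ≤ (U ∩ C').card :=
      Finset.card_le_card (Finset.inter_subset_inter_left hCC')
    have h1' : ((Sh ∪ ((U ∩ C') \ C)).card : ℝ) ≤ Sh.card + ((U ∩ C') \ C).card := by
      exact_mod_cast h1
    have h2' : (((U ∩ C') \ C).card : ℝ) + (U ∩ C).card = (U ∩ C').card := by exact_mod_cast h2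
    have h3' : ((U \ C').card : ℝ) + (U ∩ C').card = U.card := by exact_mod_cast h3
    have h4' : (((U \ C') ∩ Exc).card : ℝ) ≤ (U ∩ Exc).card := by exact_mod_cast h4
    have h5' : ((U ∩ C).card : ℝ) ≤ (U ∩ C').card := by exact_mod_cast h5
    rw [← h3']
    nlinarith
  · -- a point outside the exceptional set lies in the new cell or in the rest treated before
    have hcase : ∀ p ∈ U \ (Sh ∪ ((U ∩ C') \ C)), p ∈ C ∨ (p ∉ C' ∧ p ∈ (U \ C') \ Sh) := by
      intro p hp
      obtain ⟨hpU, hpS⟩ := Finset.mem_sdiff.mp hp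
      rw [Finset.mem_union, not_or] at hpS
      by_cases hpC : p ∈ C
      · exact Or.inl hpC
      · have hpC' : p ∉ C' := fun h =>
          hpS.2 (Finset.mem_sdiff.mpr ⟨Finset.mem_inter.mpr ⟨hpU, h⟩, hpC⟩)
        exact Or.inr ⟨hpC', Finset.mem_sdiff.mpr ⟨Finset.mem_sdiff.mpr ⟨hpU, hpC'⟩, hpS.1⟩⟩
    intro p hp j l hp'
    rcases hcase p hp with h | ⟨h, hm⟩ <;> rcases hcase _ hp' with h' | ⟨h', hm'⟩
    · simp only [h, h', if_true]
      obtain ⟨hb, he⟩ := hw p h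
      obtain ⟨hb', he'⟩ := hw _ h'
      have hz := hExc s hsE _ (sub_sub_mem_box hb hb' hRT j l) (word_sub_sub_smul ρ he he')
      rw [sum_sub_sub_mul] at hz
      linarith
    · exact absurd (div_smul_mem_wordBall ρ h j l) h'
    · refine absurd (?_ : p ∈ C') h
      have := div_smul_mem_wordBall ρ h' l j
      rwa [← mul_smul, div_mul_div_cancel, div_self', one_smul] at this
    · have h1 : p ∉ C := fun hc => h (hCC' hc)
      have h2 : (ρ j / ρ l) • p ∉ C := fun hc => h' (hCC' hc)
      simp only [h1, h2, if_false]
      exact ht p hm j l hm'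

open Classical in
/-- For finitely many commuting permutations `ρⱼ`, not all trivial, there are a height function `t`
and a class `B` of indices with a common nontrivial `ρⱼ` such that at almost all points the
members of `B` lead strictly higher than all the other `ρⱼ` do.  It suffices that the nontrivial
elements of the group have few fixed points and no small order; the thresholds depend only on
the number of the permutations and on the proportion `δ` of bad points. -/
lemma exists_increasing_class (J : Type) [Fintype J] [DecidableEq J] {δ : ℝ} (hδ : 0 < δ) :
    ∃ ε : ℝ, 0 < ε ∧ ∃ D : ℕ, ∀ {H : Type} [CommGroup H] {X : Type} [Fintype X] [MulAction H X],
      (∀ h : H, h ≠ 1 → ((Finset.univ.filter fun x : X => h • x = x).card : ℝ) ≤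
        ε * Fintype.card X) →
      (∀ h : H, h ≠ 1 → ∀ c : ℕ, 0 < c → c ≤ D → h ^ c ≠ 1) →
      ∀ ρ : J → H, (∃ j, ρ j = 1) → ρ ≠ 1 → ∃ b : J, ρ b ≠ 1 ∧ ∃ t : X → ℚ,
        ((Finset.univ.filter fun x : X =>
          ¬ ∀ j, ρ j ≠ ρ b → t (ρ j • x) < t (ρ b • x)).card : ℝ) ≤ δ * Fintype.card X := by
  classical
  rcases isEmpty_or_nonempty J with hJ | hJ
  · exact ⟨1, one_pos, 0, fun _ _ ρ _ hρ => absurd (funext fun j => isEmptyElim j) hρ⟩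
  set N := Fintype.card J with hN
  have hNpos : (0 : ℝ) < N := by exact_mod_cast Fintype.card_pos
  set δ' : ℝ := δ / (2 * N) with hδ'
  have hδ'pos : 0 < δ' := by positivity
  obtain ⟨T, hT0, hT⟩ : ∃ T : ℕ, 0 < T ∧ ((2 * T + 1 : ℕ) : ℝ) ^ N < (1 + δ') ^ T := by
    have h := tendsto_pow_const_div_const_pow_of_one_lt N (r := 1 + δ') (by linarith)
    have h3 : (0 : ℝ) < ((3 : ℝ) ^ N)⁻¹ := by positivity
    obtain ⟨T, h1, hT⟩ := ((h.eventually_lt_const h3).and (eventually_gt_atTop 0)).exists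
    refine ⟨T, hT, ?_⟩
    rw [div_lt_iff₀ (by positivity), inv_mul_eq_div, lt_div_iff₀ (by positivity),
      ← mul_pow] at h1
    refine lt_of_le_of_lt (pow_le_pow_left₀ (by positivity) ?_ N) h1
    have : (1 : ℝ) ≤ T := by exact_mod_cast hT
    push_cast
    linarith
  obtain ⟨D, hD⟩ := exists_separating_functional J (2 * T)
  have hbox : (0 : ℝ) < (box J (2 * T)).card := by
    rw [card_box]; positivity
  refine ⟨δ' / (box J (2 * T)).card, by positivity, D, ?_⟩
  intro H _ X _ _ hfix hord ρ ⟨j₀, hj₀⟩ hρ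
  obtain ⟨θ, hθ, hsep⟩ := hD ρ fun j l hjl => hord _ (div_ne_one.mpr hjl)
  have hsingle : ∀ j, ρ j = 1 → θ j = 0 := by
    intro j hj
    have := hθ (Pi.single j 1) ?_ (by rw [word_single, hj])
    · simpa [Pi.single_apply] using this
    · rw [mem_box]
      intro i
      have : (1 : ℤ) ≤ T := by exact_mod_cast hT0
      rw [Pi.single_apply]
      split_ifs <;> push_cast <;> simp <;> linarith
  obtain ⟨j₁, hj₁⟩ : ∃ j, ρ j ≠ 1 := by
    by_contra! h
    exact hρ (funext h)
  have main : ∀ θ : J → ℚ, (∀ u ∈ box J (2 * T), word ρ u = 1 → ∑ j, (u j : ℚ) * θ j = 0) →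
      (∀ j l, ρ j ≠ ρ l → θ j ≠ θ l) → (∀ j, ρ j = 1 → θ j = 0) → (∃ j, 0 < θ j) →
      ∃ b : J, ρ b ≠ 1 ∧ ∃ t : X → ℚ,
        ((Finset.univ.filter fun x : X =>
          ¬ ∀ j, ρ j ≠ ρ b → t (ρ j • x) < t (ρ b • x)).card : ℝ) ≤ δ * Fintype.card X := by
    intro θ hθ hsep hone ⟨j₀, hj₀⟩
    obtain ⟨b, -, hb⟩ := Finset.exists_max_image Finset.univ θ ⟨j₀, Finset.mem_univ _⟩
    set Exc : Finset X := (box J (2 * T)).biUnion fun u =>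
      if word ρ u = 1 then ∅ else Finset.univ.filter fun x : X => word ρ u • x = x with hE
    have hExc : ∀ s ∉ Exc, ∀ u ∈ box J (2 * T), word ρ u • s = s → ∑ j, (u j : ℚ) * θ j = 0 := by
      intro s hs u hu hus
      refine hθ u hu ?_
      by_contra hw
      refine hs (Finset.mem_biUnion.mpr ⟨u, hu, ?_⟩)
      rw [if_neg hw]
      simp [hus]
    have hEcard : (Exc.card : ℝ) ≤ δ' * Fintype.card X := by
      calc (Exc.card : ℝ) ≤ ∑ u ∈ box J (2 * T), ((if word ρ u = 1 then (∅ : Finset X) else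
            Finset.univ.filter fun x : X => word ρ u • x = x).card : ℝ) := by
            exact_mod_cast Finset.card_biUnion_le
        _ ≤ ∑ u ∈ box J (2 * T), δ' / (box J (2 * T)).card * Fintype.card X := by
            refine Finset.sum_le_sum fun u _ => ?_
            split_ifs with h
            · simp only [Finset.card_empty, Nat.cast_zero]; positivity
            · exact hfix _ h
        _ = _ := by
            rw [Finset.sum_const, nsmul_eq_mul]
            field_simp
    obtain ⟨Sh, -, hSh, t, ht⟩ := exists_height ρ θ hδ'pos hT Exc hExc Finset.univ
    rw [Finset.univ_inter, Finset.card_univ] at hSh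
    -- bad points are taken into the exceptional set `Sh` of the height function by some `ρ j`
    refine ⟨b, fun h => ?_, t, ?_⟩
    · have := hb j₀ (Finset.mem_univ _)
      rw [hone b h] at this
      linarith
    · have hsub : (Finset.univ.filter fun x : X =>
          ¬ ∀ j, ρ j ≠ ρ b → t (ρ j • x) < t (ρ b • x)) ⊆
          Finset.univ.biUnion fun j : J => Sh.image fun p => (ρ j)⁻¹ • p := by
        intro x hx
        by_contra hcon
        have hall : ∀ j, ρ j • x ∈ Finset.univ \ Sh := by
          intro j
          rw [Finset.mem_sdiff]
          refine ⟨Finset.mem_univ _, fun hm => hcon (Finset.mem_biUnion.mpr ⟨j, Finset.mem_univ _,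
            Finset.mem_image.mpr ⟨_, hm, inv_smul_smul _ _⟩⟩)⟩
        refine (Finset.mem_filter.mp hx).2 fun j hj => ?_
        have h1 := ht _ (hall j) b j (by rw [← mul_smul, div_mul_cancel]; exact hall b)
        rw [← mul_smul, div_mul_cancel] at h1
        have h2 := lt_of_le_of_ne (hb j (Finset.mem_univ _)) (hsep j b hj)
        rw [h1]
        linarith
      have hcard := (Finset.card_le_card hsub).trans Finset.card_biUnion_le
      have hcard2 : ∑ j : J, (Sh.image fun p => (ρ j)⁻¹ • p).card ≤ N * Sh.card := by
        rw [hN, ← Finset.card_univ, ← smul_eq_mul, ← Finset.sum_const]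
        exact Finset.sum_le_sum fun j _ => Finset.card_image_le
      have hcard3 : ((Finset.univ.filter fun x : X =>
          ¬ ∀ j, ρ j ≠ ρ b → t (ρ j • x) < t (ρ b • x)).card : ℝ) ≤ N * Sh.card := by
        exact_mod_cast hcard.trans hcard2
      refine hcard3.trans ?_
      have h3 : (Sh.card : ℝ) ≤ 2 * δ' * Fintype.card X := by linarith
      calc (N : ℝ) * Sh.card ≤ N * (2 * δ' * Fintype.card X) := by gcongr
        _ = δ * Fintype.card X := by rw [hδ']; field_simp
  -- the sign of the functional is chosen so that its largest value is positive
  rcases lt_or_ge 0 (θ j₁) with h | h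
  · exact main θ hθ hsep hsingle ⟨j₁, h⟩
  · refine main (-θ) ?_ ?_ ?_ ⟨j₁, ?_⟩
    · intro u hu hw
      simp [hθ u hu hw]
    · intro j l hjl h
      exact hsep j l hjl (neg_injective h)
    · intro j hj
      simp [hsingle j hj]
    · have : θ j₁ ≠ 0 := by
        rw [← hsingle j₀ hj₀]
        exact hsep _ _ (by rwa [hj₀])
      rw [Pi.neg_apply]
      exact neg_pos.mpr (lt_of_le_of_ne h this)

end Order

/-! ### The largest singular value of a nonnegative matrix -/

section Singular

variable {U W : Type} [Fintype U] [Fintype W]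

lemma sum_sq_div_sqrt {b : W → ℝ} (hb : 0 < ∑ w, b w ^ 2) :
    ∑ w, (b w / √(∑ w, b w ^ 2)) ^ 2 = 1 := by
  simp only [div_pow, Real.sq_sqrt hb.le, ← Finset.sum_div]
  exact div_self hb.ne'

/-- The square `lam` of the largest singular value of a nonnegative matrix `K`, with a
nonnegative singular vector. -/
lemma exists_top_singular [Nonempty W] (K : U → W → ℝ) (hK : ∀ u w, 0 ≤ K u w) :
    ∃ lam : ℝ, 0 ≤ lam ∧
      (∀ (a : U → ℝ) (b : W → ℝ), ∑ u, ∑ w, K u w * a u * b w ≤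
        √lam * (√(∑ u, a u ^ 2) * √(∑ w, b w ^ 2))) ∧
      ∃ b : W → ℝ, (∀ w, 0 ≤ b w) ∧ ∑ w, b w ^ 2 = 1 ∧
        ∀ w, ∑ u, K u w * ∑ w', K u w' * b w' = lam * b w := by
  classical
  set f : (W → ℝ) → ℝ := fun b => ∑ u, (∑ w, K u w * b w) ^ 2 with hf
  have hfc : Continuous f := by fun_prop
  set S : Set (W → ℝ) := {b | ∑ w, b w ^ 2 = 1} with hS
  have hScl : IsClosed S := isClosed_eq (by fun_prop) continuous_const
  have hSb : Bornology.IsBounded S := by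
    refine (Metric.isBounded_closedBall (x := (0 : W → ℝ)) (r := 1)).subset fun b hb => ?_
    rw [mem_closedBall_zero_iff, pi_norm_le_iff_of_nonneg zero_le_one]
    intro w
    rw [Real.norm_eq_abs, ← sq_le_one_iff_abs_le_one]
    exact (Finset.single_le_sum (f := fun w => b w ^ 2) (fun _ _ => sq_nonneg _)
      (Finset.mem_univ w)).trans_eq hb
  have hSne : S.Nonempty := by
    obtain ⟨w₀⟩ := ‹Nonempty W›
    exact ⟨Pi.single w₀ 1, by simp [hS, Pi.single_apply]⟩
  obtain ⟨b₀, hb₀S, hb₀⟩ := (Metric.isCompact_of_isClosed_isBounded hScl hSb).exists_isMaxOn hSne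
    hfc.continuousOn
  set b : W → ℝ := fun w => |b₀ w| with hb
  have hbS : ∑ w, b w ^ 2 = 1 := by
    simp only [hb, sq_abs]
    exact hb₀S
  have hfb : f b₀ ≤ f b := by
    refine Finset.sum_le_sum fun u _ => sq_le_sq.mpr ?_
    refine (Finset.abs_sum_le_sum_abs _ _).trans (le_trans (le_of_eq ?_) (le_abs_self _))
    refine Finset.sum_congr rfl fun w _ => ?_
    rw [abs_mul, abs_of_nonneg (hK u w)]
  set lam := f b with hlam
  have hlam0 : 0 ≤ lam := Finset.sum_nonneg fun _ _ => sq_nonneg _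
  have hmax : ∀ c : W → ℝ, f c ≤ lam * ∑ w, c w ^ 2 := by
    intro c
    rcases (Finset.sum_nonneg fun w (_ : w ∈ Finset.univ) => sq_nonneg (c w)).eq_or_lt with h | h
    · have hc : ∀ w, c w = 0 := fun w => by
        have := (Finset.sum_eq_zero_iff_of_nonneg fun w _ => sq_nonneg (c w)).mp h.symm w
          (Finset.mem_univ w)
        exact pow_eq_zero_iff two_ne_zero |>.mp this
      simp [hf, hc]
    · have h1 : f (fun w => c w / √(∑ w, c w ^ 2)) ≤ lam :=
        (hb₀ (sum_sq_div_sqrt h)).trans hfb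
      have h2 : f (fun w => c w / √(∑ w, c w ^ 2)) = f c / ∑ w, c w ^ 2 := by
        simp only [hf, ← mul_div_assoc, ← Finset.sum_div, div_pow, Real.sq_sqrt h.le]
      rwa [h2, div_le_iff₀ h] at h1
  have hsqrt : ∀ c : W → ℝ, √(f c) ≤ √lam * √(∑ w, c w ^ 2) := fun c => by
    rw [← Real.sqrt_mul hlam0]
    exact Real.sqrt_le_sqrt (hmax c)
  refine ⟨lam, hlam0, fun a c => ?_, b, fun w => abs_nonneg _, hbS, ?_⟩
  · calc ∑ u, ∑ w, K u w * a u * c w = ∑ u, a u * ∑ w, K u w * c w := by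
          refine Finset.sum_congr rfl fun u _ => ?_
          rw [Finset.mul_sum]
          exact Finset.sum_congr rfl fun w _ => by ring
      _ ≤ √(∑ u, a u ^ 2) * √(f c) := Real.sum_mul_le_sqrt_mul_sqrt _ _ _
      _ ≤ √(∑ u, a u ^ 2) * (√lam * √(∑ w, c w ^ 2)) :=
          mul_le_mul_of_nonneg_left (hsqrt c) (Real.sqrt_nonneg _)
      _ = _ := by ring
  · -- `g = KᵀK b` has norm at most `lam` and inner product `lam` with `b`, so it equals `lam • b`
    set g : W → ℝ := fun w => ∑ u, K u w * ∑ w', K u w' * b w' with hg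
    have hinner : ∀ c : W → ℝ, ∑ w, c w * g w = ∑ u, (∑ w, K u w * c w) * ∑ w, K u w * b w := by
      intro c
      simp only [hg, Finset.mul_sum, Finset.sum_mul]
      rw [Finset.sum_comm]
      refine Finset.sum_congr rfl fun u _ => ?_
      rw [Finset.sum_comm]
      exact Finset.sum_congr rfl fun _ _ => Finset.sum_congr rfl fun _ _ => by ring
    have hgg : ∑ w, g w ^ 2 ≤ lam ^ 2 := by
      have h1 : ∑ w, g w ^ 2 ≤ lam * √(∑ w, g w ^ 2) := by
        calc ∑ w, g w ^ 2 = ∑ w, g w * g w := by simp only [sq]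
          _ ≤ √(f g) * √(f b) := by rw [hinner]; exact Real.sum_mul_le_sqrt_mul_sqrt _ _ _
          _ ≤ (√lam * √(∑ w, g w ^ 2)) * √lam :=
              mul_le_mul_of_nonneg_right (hsqrt g) (Real.sqrt_nonneg _)
          _ = (√lam * √lam) * √(∑ w, g w ^ 2) := by ring
          _ = _ := by rw [Real.mul_self_sqrt hlam0]
      have h0 : 0 ≤ ∑ w, g w ^ 2 := Finset.sum_nonneg fun _ _ => sq_nonneg _
      have h2 := Real.sq_sqrt h0
      have h3 := Real.sqrt_nonneg (∑ w, g w ^ 2)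
      nlinarith [sq_nonneg (lam - √(∑ w, g w ^ 2))]
    have hbg : ∑ w, b w * g w = lam := by
      rw [hinner, hlam, hf]
      simp only [sq]
    have hzero : ∑ w, (g w - lam * b w) ^ 2 ≤ 0 := by
      have : ∀ l : ℝ, ∑ w, (g w - l * b w) ^ 2 =
          ∑ w, g w ^ 2 - 2 * l * ∑ w, b w * g w + l ^ 2 * ∑ w, b w ^ 2 := by
        intro l
        rw [Finset.mul_sum, Finset.mul_sum, ← Finset.sum_sub_distrib, ← Finset.sum_add_distrib]
        exact Finset.sum_congr rfl fun _ _ => by ring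
      rw [this, hbg, hbS]
      linarith
    intro w
    have h1 : (g w - lam * b w) ^ 2 ≤ 0 :=
      (Finset.single_le_sum (f := fun w => (g w - lam * b w) ^ 2) (fun _ _ => sq_nonneg _)
        (Finset.mem_univ w)).trans hzero
    have := pow_eq_zero_iff two_ne_zero |>.mp (le_antisymm h1 (sq_nonneg _))
    linarith

end Singular

/-! ### Empirical distributions -/

section Empirical

variable {n : ℕ} {A : Type} [Fintype A] [DecidableEq A]

lemma empiricalDist_nonneg (z : Fin n → A) (a : A) : 0 ≤ empiricalDist z a := by
  unfold empiricalDist; positivity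

lemma empiricalDist_self_pos (z : Fin n → A) (i : Fin n) : 0 < empiricalDist z (z i) := by
  have hn : 0 < n := i.pos
  have : 0 < (Finset.univ.filter fun i' => z i' = z i).card :=
    Finset.card_pos.mpr ⟨i, by simp⟩
  unfold empiricalDist
  positivity

lemma sum_empiricalDist_mul (z : Fin n → A) (φ : A → ℝ) :
    ∑ a, empiricalDist z a * φ a = (∑ i, φ (z i)) / n := by
  have h : ∑ i, φ (z i) = ∑ a, ((Finset.univ.filter fun i => z i = a).card : ℝ) * φ a := by
    rw [← Finset.sum_fiberwise Finset.univ z]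
    refine Finset.sum_congr rfl fun a _ => ?_
    rw [Finset.sum_congr rfl (g := fun _ => φ a) fun i hi => by rw [(Finset.mem_filter.mp hi).2]]
    simp
  rw [h, Finset.sum_div]
  refine Finset.sum_congr rfl fun a _ => ?_
  unfold empiricalDist
  ring

lemma sum_empiricalDist (hn : 0 < n) (z : Fin n → A) : ∑ a, empiricalDist z a = 1 := by
  have := sum_empiricalDist_mul z fun _ => 1
  have hn' : (n : ℝ) ≠ 0 := by positivity
  simpa [hn'] using this

lemma entropy_empiricalDist (z : Fin n → A) :
    entropy (empiricalDist z) = -(∑ i, Real.log (empiricalDist z (z i))) / n := by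
  have := sum_empiricalDist_mul z fun a => Real.log (empiricalDist z a)
  simp only [entropy, Real.negMulLog, neg_mul, Finset.sum_neg_distrib, this, neg_div]

lemma empiricalDist_comp_perm (σ : Equiv.Perm (Fin n)) (z : Fin n → A) :
    empiricalDist (fun i => z (σ i)) = empiricalDist z := by
  funext a
  unfold empiricalDist
  congr 2
  exact Finset.card_equiv σ (by simp)

/-- Higher empirical entropy means that the sequence is less likely under its own empirical
distribution. -/
lemma prod_empiricalDist_le (hn : 0 < n) {z z' : Fin n → A}
    (h : entropy (empiricalDist z') ≤ entropy (empiricalDist z)) :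
    ∏ i, empiricalDist z (z i) ≤ ∏ i, empiricalDist z' (z' i) := by
  rw [entropy_empiricalDist, entropy_empiricalDist, div_le_div_iff_of_pos_right (by positivity),
    neg_le_neg_iff, ← Real.log_prod fun i _ => (empiricalDist_self_pos z i).ne',
    ← Real.log_prod fun i _ => (empiricalDist_self_pos z' i).ne'] at h
  exact (Real.log_le_log_iff (Finset.prod_pos fun i _ => empiricalDist_self_pos z i)
    (Finset.prod_pos fun i _ => empiricalDist_self_pos z' i)).mp h

/-- The set of all empirical distributions of sequences of length `n`. -/
noncomputable def typeSet (n : ℕ) (A : Type) [Fintype A] [DecidableEq A] : Finset (A → ℝ) :=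
  Set.Finite.toFinset (Set.finite_range fun z : Fin n → A => empiricalDist z)

lemma empiricalDist_mem_typeSet (z : Fin n → A) : empiricalDist z ∈ typeSet n A := by
  simp [typeSet]

lemma card_typeSet_le : (typeSet n A).card ≤ (n + 1) ^ Fintype.card A := by
  classical
  have h : typeSet n A ⊆ (Finset.univ : Finset (A → Fin (n + 1))).image
      fun c a => ((c a : ℕ) : ℝ) / n := by
    intro q hq
    obtain ⟨z, rfl⟩ : ∃ z : Fin n → A, empiricalDist z = q := by simpa [typeSet] using hq
    refine Finset.mem_image.mpr ⟨fun a => ⟨(Finset.univ.filter fun i => z i = a).card, ?_⟩,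
      Finset.mem_univ _, rfl⟩
    exact Nat.lt_succ_of_le ((Finset.card_le_univ _).trans_eq (Fintype.card_fin n))
  refine (Finset.card_le_card h).trans (Finset.card_image_le.trans_eq ?_)
  simp

lemma nonneg_of_mem_typeSet {q : A → ℝ} (hq : q ∈ typeSet n A) (a : A) : 0 ≤ q a := by
  obtain ⟨z, rfl⟩ : ∃ z : Fin n → A, empiricalDist z = q := by simpa [typeSet] using hq
  exact empiricalDist_nonneg z a

end Empirical

section MultiInformation

variable {n r m : ℕ}

lemma marginal_empiricalDist (z : Fin n → Fin m → Fin r) (j : Fin m) :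
    marginal (empiricalDist z) j = empiricalDist fun i => z i j := by
  funext a
  have h := sum_empiricalDist_mul z fun v => if v j = a then (1 : ℝ) else 0
  simp only [mul_ite, mul_one, mul_zero, ← Finset.sum_filter] at h
  unfold marginal
  rw [h]
  simp [empiricalDist]

/-- Permuting the pixels within each image leaves the one-image marginals alone, so that the
multiinformation increases exactly when the joint entropy decreases. -/
lemma entropy_le_of_multiInformation_le (τ : Fin m → Equiv.Perm (Fin n))
    (z : Fin n → Fin m → Fin r)
    (h : multiInformation (empiricalDist z) ≤
      multiInformation (empiricalDist fun i j => z (τ j i) j)) :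
    entropy (empiricalDist fun i j => z (τ j i) j) ≤ entropy (empiricalDist z) := by
  have : ∀ j, marginal (empiricalDist fun i j => z (τ j i) j) j = marginal (empiricalDist z) j := by
    intro j
    rw [marginal_empiricalDist, marginal_empiricalDist]
    exact empiricalDist_comp_perm (τ j) fun i => z i j
  simp only [multiInformation, this] at h
  linarith

end MultiInformation

/-! ### Counting misaligned images by sequential kernels -/

lemma card_mul_sum_eq_sum_update {ι V : Type} [Fintype ι] [DecidableEq ι] [Fintype V]
    (F : (ι → V) → ℝ) (l : ι) :
    (Fintype.card V : ℝ) * ∑ s, F s = ∑ s, ∑ a, F (Function.update s l a) := by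
  have hinv : Function.Involutive
      (fun p : (ι → V) × V => (Function.update p.1 l p.2, p.1 l)) := by
    rintro ⟨s, a⟩
    simp
  have h1 : ∑ p : (ι → V) × V, F (Function.update p.1 l p.2) = ∑ p : (ι → V) × V, F p.1 :=
    Equiv.sum_comp hinv.toPerm (fun p => F p.1)
  rw [Fintype.sum_prod_type, Fintype.sum_prod_type] at h1
  rw [h1]
  simp [Finset.mul_sum]

/-- If the factor at position `l` is a subprobability in the symbol at `l` and otherwise depends
only on symbols at strictly lower positions, the product of all factors is a subprobability. -/
lemma sum_prod_sequential_le_one {ι V : Type} [Fintype ι] [DecidableEq ι] [Fintype V] [Nonempty V]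
    (t : ι → ℚ) (K : ι → (ι → V) → ℝ) (hK : ∀ l s, 0 ≤ K l s)
    (hloc : ∀ l s s', s l = s' l → (∀ m, t m < t l → s m = s' m) → K l s = K l s')
    (hsum : ∀ l s, ∑ a, K l (Function.update s l a) ≤ 1) :
    ∑ s, ∏ l, K l s ≤ 1 := by
  have hV : (0 : ℝ) < Fintype.card V := by exact_mod_cast Fintype.card_pos
  have main : ∀ T : Finset ι, (Fintype.card V : ℝ) ^ T.card * ∑ s, ∏ l ∈ T, K l s ≤
      (Fintype.card V : ℝ) ^ Fintype.card ι := by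
    intro T
    induction T using Finset.induction_on_max_value t with
    | empty => simp
    | insert a T ha hmax ih =>
      refine le_trans ?_ ih
      rw [Finset.card_insert_of_notMem ha, pow_succ, mul_assoc]
      refine mul_le_mul_of_nonneg_left ?_ (by positivity)
      rw [card_mul_sum_eq_sum_update _ a]
      refine Finset.sum_le_sum fun s _ => ?_
      have h1 : ∀ v, ∏ l ∈ insert a T, K l (Function.update s a v) =
          K a (Function.update s a v) * ∏ l ∈ T, K l s := by
        intro v
        rw [Finset.prod_insert ha]
        congr 1
        refine Finset.prod_congr rfl fun l hl => hloc l _ _ ?_ fun m hm => ?_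
        · exact Function.update_of_ne (fun h : l = a => ha (h ▸ hl)) _ _
        · exact Function.update_of_ne (fun h : m = a => absurd (hmax l hl) (not_le.mpr (h ▸ hm))) _ _
      simp only [h1, ← Finset.sum_mul]
      exact mul_le_of_le_one_left (Finset.prod_nonneg fun l _ => hK l s) (hsum a s)
  have := main Finset.univ
  rw [Finset.card_univ] at this
  exact le_of_mul_le_mul_left (by rwa [mul_one]) (pow_pos hV _)

section Misaligned

variable {n : ℕ} {J F : Type} [Fintype J] [DecidableEq J] [Fintype F] [DecidableEq F]

/-- The vector-valued image `z` after the `j`-th components have been moved by `τ j`. -/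
def realign (τ : J → Equiv.Perm (Fin n)) (z : Fin n → J → F) : Fin n → J → F :=
  fun i j => z (τ j i) j

lemma realign_realign_inv (τ : J → Equiv.Perm (Fin n)) (z : Fin n → J → F) :
    realign τ⁻¹ (realign τ z) = z := by
  funext i j
  simp [realign]

lemma sum_realign (τ : J → Equiv.Perm (Fin n)) (R : (Fin n → J → F) → ℝ) :
    ∑ z, R (realign τ z) = ∑ z, R z :=
  Equiv.sum_comp (⟨realign τ, realign τ⁻¹, realign_realign_inv τ, fun z => by
    have := realign_realign_inv τ⁻¹ z
    rwa [inv_inv] at this⟩ : (Fin n → J → F) ≃ (Fin n → J → F)) R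

end Misaligned

section Misaligned

variable {n : ℕ} {J F : Type} [Fintype J] [DecidableEq J] [Fintype F] [DecidableEq F]

/-- The vector with components `w` inside `B` and `u` outside `B`. -/
def merge (B : Finset J) (w : {j // j ∈ B} → F) (u : {j // j ∉ B} → F) : J → F :=
  (Equiv.piEquivPiSubtypeProd (fun j => j ∈ B) fun _ => F).symm (w, u)

lemma merge_restrict (B : Finset J) (a : J → F) :
    merge B (fun j => a j) (fun j => a j) = a :=
  (Equiv.piEquivPiSubtypeProd (fun j => j ∈ B) fun _ => F).symm_apply_apply a

lemma merge_apply_mem (B : Finset J) (w : {j // j ∈ B} → F) (u : {j // j ∉ B} → F) {j : J}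
    (hj : j ∈ B) : merge B w u j = w ⟨j, hj⟩ := by
  simp [merge, hj]

lemma merge_apply_notMem (B : Finset J) (w : {j // j ∈ B} → F) (u : {j // j ∉ B} → F) {j : J}
    (hj : j ∉ B) : merge B w u j = u ⟨j, hj⟩ := by
  simp [merge, hj]

lemma sum_merge (B : Finset J) (G : (J → F) → ℝ) :
    ∑ a, G a = ∑ w : {j // j ∈ B} → F, ∑ u : {j // j ∉ B} → F, G (merge B w u) := by
  rw [← Equiv.sum_comp (Equiv.piEquivPiSubtypeProd (fun j => j ∈ B) fun _ => F).symm,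
    Fintype.sum_prod_type]
  rfl

/-- The marginal of `q` on the coordinates in `s`, as a function of the whole vector. -/
noncomputable def coordMarginal (s : Finset J) (q : (J → F) → ℝ) (a : J → F) : ℝ :=
  ∑ a' ∈ Finset.univ.filter (fun a' : J → F => ∀ j ∈ s, a' j = a j), q a'

lemma coordMarginal_merge (B : Finset J) (q : (J → F) → ℝ) (w : {j // j ∈ B} → F)
    (u : {j // j ∉ B} → F) : coordMarginal B q (merge B w u) = ∑ u', q (merge B w u') := by
  have h : ∀ w' u', (∀ j ∈ B, merge B w' u' j = merge B w u j) ↔ w' = w := by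
    intro w' u'
    constructor
    · intro h
      funext ⟨j, hj⟩
      have := h j hj
      rwa [merge_apply_mem B _ _ hj, merge_apply_mem B _ _ hj] at this
    · rintro rfl j hj
      rw [merge_apply_mem B _ _ hj, merge_apply_mem B _ _ hj]
  rw [coordMarginal, Finset.sum_filter, sum_merge B]
  simp only [h]
  rw [Finset.sum_comm]
  simp

lemma coordMarginal_compl_merge (B : Finset J) (q : (J → F) → ℝ) (w : {j // j ∈ B} → F)
    (u : {j // j ∉ B} → F) : coordMarginal Bᶜ q (merge B w u) = ∑ w', q (merge B w' u) := by
  have h : ∀ w' u', (∀ j ∈ Bᶜ, merge B w' u' j = merge B w u j) ↔ u' = u := by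
    intro w' u'
    constructor
    · intro h
      funext ⟨j, hj⟩
      have := h j (Finset.mem_compl.mpr hj)
      rwa [merge_apply_notMem B _ _ hj, merge_apply_notMem B _ _ hj] at this
    · rintro rfl j hj
      have hj := Finset.mem_compl.mp hj
      rw [merge_apply_notMem B _ _ hj, merge_apply_notMem B _ _ hj]
  rw [coordMarginal, Finset.sum_filter, sum_merge B]
  simp only [h]
  simp

lemma coordMarginal_nonneg {q : (J → F) → ℝ} (hq : ∀ a, 0 ≤ q a) (s : Finset J) (a : J → F) :
    0 ≤ coordMarginal s q a :=
  Finset.sum_nonneg fun _ _ => hq _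

lemma le_coordMarginal {q : (J → F) → ℝ} (hq : ∀ a, 0 ≤ q a) (s : Finset J) (a : J → F) :
    q a ≤ coordMarginal s q a :=
  Finset.single_le_sum (f := q) (fun _ _ => hq _)
    (Finset.mem_filter.mpr ⟨Finset.mem_univ _, fun _ _ => rfl⟩)

/-- The conditional probability of the vector `a` given its coordinates in `s`. -/
noncomputable def condLaw (s : Finset J) (q : (J → F) → ℝ) (a : J → F) : ℝ :=
  q a / coordMarginal s q a

lemma condLaw_nonneg {q : (J → F) → ℝ} (hq : ∀ a, 0 ≤ q a) (s : Finset J) (a : J → F) :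
    0 ≤ condLaw s q a :=
  div_nonneg (hq a) (coordMarginal_nonneg hq s a)

lemma condLaw_le_one {q : (J → F) → ℝ} (hq : ∀ a, 0 ≤ q a) (s : Finset J) (a : J → F) :
    condLaw s q a ≤ 1 :=
  div_le_one_of_le₀ (le_coordMarginal hq s a) (coordMarginal_nonneg hq s a)

lemma sum_condLaw_le_one (B : Finset J) (q : (J → F) → ℝ) (w : {j // j ∈ B} → F) :
    ∑ u, condLaw B q (merge B w u) ≤ 1 := by
  simp only [condLaw, coordMarginal_merge, ← Finset.sum_div]
  exact div_self_le_one _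

lemma sum_condLaw_compl_le_one (B : Finset J) (q : (J → F) → ℝ) (u : {j // j ∉ B} → F) :
    ∑ w, condLaw Bᶜ q (merge B w u) ≤ 1 := by
  simp only [condLaw, coordMarginal_compl_merge, ← Finset.sum_div]
  exact div_self_le_one _

variable [Nonempty F]

open Classical in
/-- A sequential description of the image `s` and its realignment by `ρ`.  The coordinates in the
class `B` of the index `b` have the highest positions in each pixel of the realigned image, so
their values are drawn given the other coordinates of that pixel; the remaining coordinates of
the pixel of `s` are then drawn given those in `B`.  At the pixels where the order fails, the
uniform distribution is used instead. -/
lemma sum_kernel_le_one (ρ : J → Equiv.Perm (Fin n)) (b : J) (t : Fin n → ℚ) {B : Finset J}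
    (hB : ∀ j, j ∈ B ↔ ρ j = ρ b) {v₁ v₂ : (J → F) → ℝ} (h₁ : ∀ a, 0 ≤ v₁ a) (h₂ : ∀ a, 0 ≤ v₂ a)
    (hs₁ : ∀ w, ∑ u, v₁ (merge B w u) ≤ 1) (hs₂ : ∀ u, ∑ w, v₂ (merge B w u) ≤ 1) :
    ∑ s : Fin n → J → F, (∏ l, v₁ (s l)) *
      ∏ i, (if ∀ j, ρ j ≠ ρ b → t (ρ j i) < t (ρ b i) then v₂ (realign ρ s i)
        else (Fintype.card (J → F) : ℝ)⁻¹) ≤ 1 := by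
  set Vf : Fin n → (J → F) → ℝ := fun i a =>
    if ∀ j, ρ j ≠ ρ b → t (ρ j i) < t (ρ b i) then v₂ a else (Fintype.card (J → F) : ℝ)⁻¹ with hVf
  have hVf0 : ∀ i a, 0 ≤ Vf i a := by
    intro i a
    simp only [hVf]
    split_ifs
    · exact h₂ a
    · positivity
  set K : Fin n → (Fin n → J → F) → ℝ := fun l s =>
    v₁ (s l) * Vf ((ρ b)⁻¹ l) (realign ρ s ((ρ b)⁻¹ l)) with hK
  have hinv : ∀ l, ρ b ((ρ b)⁻¹ l) = l := fun l => by simp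
  have hprod : ∀ s : Fin n → J → F,
      (∏ l, v₁ (s l)) * ∏ i, Vf i (realign ρ s i) = ∏ l, K l s := by
    intro s
    rw [Finset.prod_mul_distrib, Equiv.prod_comp (ρ b)⁻¹ fun i => Vf i (realign ρ s i)]
  change ∑ s : Fin n → J → F, (∏ l, v₁ (s l)) * ∏ i, Vf i (realign ρ s i) ≤ 1
  simp only [hprod]
  refine sum_prod_sequential_le_one t K (fun l s => mul_nonneg (h₁ _) (hVf0 _ _)) ?_ ?_
  · intro l s s' hl hlow
    simp only [hK, hVf, hl]
    split_ifs with hgood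
    · congr 2
      funext j
      simp only [realign]
      by_cases hj : ρ j = ρ b
      · rw [hj, hinv, hl]
      · have := hgood j hj
        rw [hinv] at this
        rw [hlow _ this]
    · rfl
  · intro l s
    rw [sum_merge B]
    by_cases hgood : ∀ j, ρ j ≠ ρ b → t (ρ j ((ρ b)⁻¹ l)) < t (ρ b ((ρ b)⁻¹ l))
    · have hre : ∀ w u, realign ρ (Function.update s l (merge B w u)) ((ρ b)⁻¹ l) =
          merge B w (fun j => s (ρ j ((ρ b)⁻¹ l)) j) := by
        intro w u
        funext j
        simp only [realign]
        by_cases hj : j ∈ B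
        · rw [(hB j).mp hj, hinv, Function.update_self,
            merge_apply_mem B _ _ hj, merge_apply_mem B _ _ hj]
        · have := hgood j (fun h => hj ((hB j).mpr h))
          rw [hinv] at this
          rw [merge_apply_notMem B _ _ hj, Function.update_of_ne (fun h => ?_)]
          rw [h] at this
          exact lt_irrefl _ this
      simp only [hK, hVf, if_pos hgood, hre, Function.update_self, ← Finset.sum_mul]
      calc _ ≤ ∑ w, v₂ (merge B w fun j => s (ρ j ((ρ b)⁻¹ l)) j) :=
            Finset.sum_le_sum fun w _ => mul_le_of_le_one_left (h₂ _) (hs₁ w)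
        _ ≤ 1 := hs₂ _
    · simp only [hK, hVf, if_neg hgood, Function.update_self, ← Finset.sum_mul]
      have hc : (0 : ℝ) < Fintype.card (J → F) := by exact_mod_cast Fintype.card_pos
      rw [← div_eq_mul_inv, div_le_one hc]
      calc ∑ w, ∑ u, v₁ (merge B w u) ≤ ∑ w : {j // j ∈ B} → F, (1 : ℝ) :=
            Finset.sum_le_sum fun w _ => hs₁ w
        _ = Fintype.card ({j // j ∈ B} → F) := by simp
        _ ≤ Fintype.card (J → F) := by
            obtain ⟨a₀⟩ := ‹Nonempty F›
            exact_mod_cast Fintype.card_le_of_injective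
              (fun w : {j // j ∈ B} → F => merge B w fun _ => a₀) fun w w' h => by
                funext ⟨j, hj⟩
                have := congrFun h j
                simpa [merge_apply_mem B _ _ hj] using this

end Misaligned

/-! ### The probability of a confusion -/

section Confusion

variable {n : ℕ} {J F : Type} [Fintype J] [DecidableEq J] [Fintype F] [DecidableEq F]

lemma prod_le_mean_pow (hn : 0 < n) {x : Fin n → ℝ} (hx : ∀ i, 0 ≤ x i) :
    ∏ i, x i ≤ ((∑ i, x i) / n) ^ n := by
  have hn' : (n : ℝ) ≠ 0 := by positivity
  have h := Real.geom_mean_le_arith_mean_weighted Finset.univ (fun _ : Fin n => (n : ℝ)⁻¹) x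
    (fun _ _ => by positivity) (by simp [hn']) fun i _ => hx i
  rw [Real.finsetProd_rpow _ _ fun i _ => hx i, ← Finset.mul_sum, inv_mul_eq_div] at h
  have h0 : 0 ≤ ∏ i, x i := Finset.prod_nonneg fun i _ => hx i
  calc ∏ i, x i = ((∏ i, x i) ^ ((n : ℝ)⁻¹)) ^ n := (Real.rpow_inv_natCast_pow h0 hn.ne').symm
    _ ≤ _ := pow_le_pow_left₀ (Real.rpow_nonneg h0 _) h n

/-- The operator norm of the matrix `√Q`, with rows indexed by the values of the coordinates
outside `B` and columns by those of the coordinates in `B`, is at most `√lam`. -/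
def GainBound (Q : (J → F) → ℝ) (lam : ℝ) (B : Finset J) : Prop :=
  ∀ (α : ({j // j ∉ B} → F) → ℝ) (β : ({j // j ∈ B} → F) → ℝ),
    ∑ u, ∑ w, √(Q (merge B w u)) * α u * β w ≤ √lam * (√(∑ u, α u ^ 2) * √(∑ w, β w ^ 2))

lemma sum_sqrt_marginals_le {Q : (J → F) → ℝ} {lam : ℝ} {B : Finset J} (hgain : GainBound Q lam B)
    {q : (J → F) → ℝ} (hq : ∀ a, 0 ≤ q a) (hq1 : ∑ a, q a = 1) :
    ∑ a, √(Q a) * √(coordMarginal Bᶜ q a) * √(coordMarginal B q a) ≤ √lam := by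
  rw [sum_merge B, Finset.sum_comm]
  simp only [coordMarginal_merge, coordMarginal_compl_merge]
  refine (hgain _ _).trans (le_of_eq ?_)
  have h1 : ∑ u, √(∑ w, q (merge B w u)) ^ 2 = 1 := by
    simp only [Real.sq_sqrt (Finset.sum_nonneg fun _ _ => hq _)]
    rw [Finset.sum_comm, ← sum_merge, hq1]
  have h2 : ∑ w, √(∑ u, q (merge B w u)) ^ 2 = 1 := by
    simp only [Real.sq_sqrt (Finset.sum_nonneg fun _ _ => hq _)]
    rw [← sum_merge, hq1]
  rw [h1, h2, Real.sqrt_one, one_mul, mul_one]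

/-- The probability of an image is at most `lam ^ n` times the product of its empirical
conditional probabilities in both directions. -/
lemma prod_le_gain_mul_prod_condLaw (hn : 0 < n) {Q : (J → F) → ℝ} (hQ : ∀ a, 0 ≤ Q a) {lam : ℝ}
    (hlam : 0 ≤ lam) {B : Finset J} (hgain : GainBound Q lam B) (z : Fin n → J → F) :
    ∏ i, Q (z i) ≤ lam ^ n * ((∏ i, condLaw B (empiricalDist z) (z i)) *
      ∏ i, condLaw Bᶜ (empiricalDist z) (z i)) := by
  set q := empiricalDist z with hq
  have hq0 : ∀ a, 0 ≤ q a := empiricalDist_nonneg z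
  -- the empirical mean of `x` is at most `√lam`, and its square compares `Q` with the two
  -- conditional laws
  set x : (J → F) → ℝ := fun a =>
    √(Q a) * √(coordMarginal Bᶜ q a) * √(coordMarginal B q a) / q a with hx
  have hx0 : ∀ a, 0 ≤ x a := fun a => div_nonneg (by positivity) (hq0 a)
  have hmean : (∑ i, x (z i)) / n ≤ √lam := by
    rw [← sum_empiricalDist_mul z x]
    refine le_trans (Finset.sum_le_sum fun a _ => ?_)
      (sum_sqrt_marginals_le hgain hq0 (sum_empiricalDist hn z))
    rcases (hq0 a).eq_or_lt with h | h
    · rw [← hq, ← h, zero_mul]; positivity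
    · exact le_of_eq (mul_div_cancel₀ _ h.ne')
  have hprod : ∏ i, x (z i) ≤ √lam ^ n :=
    (prod_le_mean_pow hn fun i => hx0 _).trans (pow_le_pow_left₀
      (div_nonneg (Finset.sum_nonneg fun i _ => hx0 _) (Nat.cast_nonneg _)) hmean n)
  have hsq : (∏ i, x (z i)) ^ 2 ≤ lam ^ n := by
    calc (∏ i, x (z i)) ^ 2 ≤ (√lam ^ n) ^ 2 :=
          pow_le_pow_left₀ (Finset.prod_nonneg fun i _ => hx0 _) hprod 2
      _ = lam ^ n := by rw [← pow_mul, mul_comm n 2, pow_mul, Real.sq_sqrt hlam]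
  have hc : ∀ i, Q (z i) = x (z i) ^ 2 * (condLaw B q (z i) * condLaw Bᶜ q (z i)) := by
    intro i
    have h1 : 0 < q (z i) := empiricalDist_self_pos z i
    have h2 : 0 < coordMarginal B q (z i) := h1.trans_le (le_coordMarginal hq0 _ _)
    have h3 : 0 < coordMarginal Bᶜ q (z i) := h1.trans_le (le_coordMarginal hq0 _ _)
    simp only [hx, condLaw, div_pow, mul_pow, Real.sq_sqrt (hQ _), Real.sq_sqrt h2.le,
      Real.sq_sqrt h3.le]
    field_simp
  calc ∏ i, Q (z i) = (∏ i, x (z i)) ^ 2 *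
        ((∏ i, condLaw B q (z i)) * ∏ i, condLaw Bᶜ q (z i)) := by
        rw [Finset.prod_congr rfl fun i _ => hc i, Finset.prod_mul_distrib,
          Finset.prod_mul_distrib, Finset.prod_pow]
    _ ≤ _ := by
        refine mul_le_mul_of_nonneg_right hsq (mul_nonneg ?_ ?_)
        · exact Finset.prod_nonneg fun i _ => condLaw_nonneg hq0 _ _
        · exact Finset.prod_nonneg fun i _ => condLaw_nonneg hq0 _ _

lemma coordMarginal_empiricalDist (s : Finset J) (z : Fin n → J → F) (a : J → F) :
    coordMarginal s (empiricalDist z) a =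
      ((Finset.univ.filter fun i => ∀ j ∈ s, z i j = a j).card : ℝ) / n := by
  have h := sum_empiricalDist_mul z fun a' => if ∀ j ∈ s, a' j = a j then (1 : ℝ) else 0
  simp only [mul_ite, mul_one, mul_zero, ← Finset.sum_filter] at h
  rw [coordMarginal, h]
  simp

/-- A class of coordinates that are all moved by the same permutation keeps its marginal. -/
lemma prod_coordMarginal_realign {τ : J → Equiv.Perm (Fin n)} {s : Finset J}
    {h : Equiv.Perm (Fin n)} (hs : ∀ j ∈ s, τ j = h) (z : Fin n → J → F) :
    ∏ i, coordMarginal s (empiricalDist (realign τ z)) (realign τ z i) =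
      ∏ i, coordMarginal s (empiricalDist z) (z i) := by
  rw [← Equiv.prod_comp h fun i => coordMarginal s (empiricalDist z) (z i)]
  refine Finset.prod_congr rfl fun i _ => ?_
  rw [coordMarginal_empiricalDist, coordMarginal_empiricalDist]
  congr 2
  refine Finset.card_equiv h fun i' => ?_
  rw [Finset.mem_filter_univ, Finset.mem_filter_univ]
  exact forall₂_congr fun j hj => by simp only [realign, hs j hj]

variable [Nonempty F]

open Classical in
/-- The probability that misaligning the components by `τ` does not increase the joint empirical
entropy, in terms of an almost everywhere increasing order for `τ⁻¹` with leading class `B`. -/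
lemma sum_confused_le (hn : 0 < n) {Q : (J → F) → ℝ} (hQ : ∀ a, 0 ≤ Q a) {lam : ℝ}
    (hlam : 0 ≤ lam) {B : Finset J} (hgain : GainBound Q lam B) (τ : J → Equiv.Perm (Fin n))
    (b : J) (hB : ∀ j, j ∈ B ↔ τ⁻¹ j = τ⁻¹ b) (t : Fin n → ℚ) :
    ∑ z : Fin n → J → F, (∏ i, Q (z i)) *
      (if entropy (empiricalDist (realign τ z)) ≤ entropy (empiricalDist z) then 1 else 0) ≤
    lam ^ n * (Fintype.card (J → F) : ℝ) ^ (Finset.univ.filter fun i : Fin n =>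
      ¬ ∀ j, τ⁻¹ j ≠ τ⁻¹ b → t (τ⁻¹ j i) < t (τ⁻¹ b i)).card *
      ((n + 1 : ℝ) ^ Fintype.card (J → F)) ^ 2 := by
  set ρ := τ⁻¹ with hρ
  set c : ℝ := ((Fintype.card (J → F) : ℕ) : ℝ) with hc
  have hc0 : 0 < c := by rw [hc]; exact_mod_cast Fintype.card_pos
  set good : Fin n → Prop := fun i => ∀ j, ρ j ≠ ρ b → t (ρ j i) < t (ρ b i) with hgood
  set N := (Finset.univ.filter fun i : Fin n => ¬ good i).card with hN
  -- `R (q, q')` is the kernel of `sum_kernel_le_one` for fixed empirical distributions `q` of the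
  -- image and `q'` of the realigned image; at bad pixels a conditional probability is bounded by
  -- `1 = c * c⁻¹`
  set R : ((J → F) → ℝ) × ((J → F) → ℝ) → (Fin n → J → F) → ℝ := fun p s =>
    (∏ l, condLaw B p.2 (s l)) *
      ∏ i, (if good i then condLaw Bᶜ p.1 (realign ρ s i) else c⁻¹) with hR
  set S := typeSet n (J → F) ×ˢ typeSet n (J → F) with hS
  have hS0 : ∀ p ∈ S, (∀ a, 0 ≤ p.1 a) ∧ ∀ a, 0 ≤ p.2 a := fun p hp =>
    ⟨nonneg_of_mem_typeSet (Finset.mem_product.mp hp).1,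
      nonneg_of_mem_typeSet (Finset.mem_product.mp hp).2⟩
  have hR0 : ∀ p ∈ S, ∀ s, 0 ≤ R p s := by
    intro p hp s
    refine mul_nonneg (Finset.prod_nonneg fun l _ => condLaw_nonneg (hS0 p hp).2 _ _)
      (Finset.prod_nonneg fun i _ => ?_)
    split_ifs
    · exact condLaw_nonneg (hS0 p hp).1 _ _
    · positivity
  have hRsum : ∀ p ∈ S, ∑ z, R p (realign τ z) ≤ 1 := by
    intro p hp
    rw [sum_realign τ (R p)]
    exact sum_kernel_le_one ρ b t hB (condLaw_nonneg (hS0 p hp).2 B)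
      (condLaw_nonneg (hS0 p hp).1 Bᶜ) (sum_condLaw_le_one B _) (sum_condLaw_compl_le_one B _)
  have hpoint : ∀ z : Fin n → J → F, (∏ i, Q (z i)) *
      (if entropy (empiricalDist (realign τ z)) ≤ entropy (empiricalDist z) then 1 else 0) ≤
      lam ^ n * c ^ N * ∑ p ∈ S, R p (realign τ z) := by
    intro z
    split_ifs with hent
    swap
    · rw [mul_zero]
      exact mul_nonneg (by positivity) (Finset.sum_nonneg fun p hp => hR0 p hp _)
    set f := realign τ z with hf
    set q := empiricalDist z with hq
    set q' := empiricalDist f with hq'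
    have hq0 : ∀ a, 0 ≤ q a := empiricalDist_nonneg z
    have hq'0 : ∀ a, 0 ≤ q' a := empiricalDist_nonneg f
    have hmem : (q, q') ∈ S :=
      Finset.mem_product.mpr ⟨empiricalDist_mem_typeSet z, empiricalDist_mem_typeSet f⟩
    -- the marginal on `B` is not affected by `τ`, so this is the entropy inequality
    have h1 : ∏ i, condLaw B q (z i) ≤ ∏ l, condLaw B q' (f l) := by
      simp only [condLaw, Finset.prod_div_distrib]
      have : ∏ l, coordMarginal B q' (f l) = ∏ i, coordMarginal B q (z i) :=
        prod_coordMarginal_realign (h := τ b) (fun j hj => inv_injective ((hB j).mp hj)) z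
      rw [this]
      exact div_le_div_of_nonneg_right (prod_empiricalDist_le hn hent)
        (Finset.prod_nonneg fun i _ => coordMarginal_nonneg hq0 _ _)
    have h2 : ∏ i, condLaw Bᶜ q (z i) ≤
        c ^ N * ∏ i, (if good i then condLaw Bᶜ q (z i) else c⁻¹) := by
      have hcN : c ^ N = ∏ i : Fin n, (if good i then 1 else c) := by
        rw [Finset.prod_ite, Finset.prod_const_one, one_mul, Finset.prod_const]
      rw [hcN, ← Finset.prod_mul_distrib]
      refine Finset.prod_le_prod (fun i _ => condLaw_nonneg hq0 _ _) fun i _ => ?_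
      split_ifs
      · rw [one_mul]
      · rw [mul_inv_cancel₀ hc0.ne']
        exact condLaw_le_one hq0 _ _
    have hRz : R (q, q') f = (∏ l, condLaw B q' (f l)) *
        ∏ i, (if good i then condLaw Bᶜ q (z i) else c⁻¹) := by
      simp only [hR, hρ, hf, realign_realign_inv]
    rw [mul_one]
    calc ∏ i, Q (z i) ≤ lam ^ n * ((∏ i, condLaw B q (z i)) * ∏ i, condLaw Bᶜ q (z i)) :=
          prod_le_gain_mul_prod_condLaw hn hQ hlam hgain z
      _ ≤ lam ^ n * ((∏ l, condLaw B q' (f l)) *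
          (c ^ N * ∏ i, (if good i then condLaw Bᶜ q (z i) else c⁻¹))) := by
          refine mul_le_mul_of_nonneg_left (mul_le_mul h1 h2 ?_ ?_) (by positivity)
          · exact Finset.prod_nonneg fun i _ => condLaw_nonneg hq0 _ _
          · exact Finset.prod_nonneg fun i _ => condLaw_nonneg hq'0 _ _
      _ = lam ^ n * c ^ N * R (q, q') f := by rw [hRz]; ring
      _ ≤ lam ^ n * c ^ N * ∑ p ∈ S, R p f :=
          mul_le_mul_of_nonneg_left (Finset.single_le_sum (f := fun p => R p f)
            (fun p hp => hR0 p hp f) hmem) (by positivity)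
  have hcard : (S.card : ℝ) ≤ ((n + 1 : ℝ) ^ Fintype.card (J → F)) ^ 2 := by
    rw [hS, Finset.card_product, ← sq]
    push_cast
    have : ((typeSet n (J → F)).card : ℝ) ≤ (n + 1 : ℝ) ^ Fintype.card (J → F) := by
      exact_mod_cast card_typeSet_le (n := n) (A := J → F)
    exact pow_le_pow_left₀ (Nat.cast_nonneg _) this 2
  calc _ ≤ ∑ z, lam ^ n * c ^ N * ∑ p ∈ S, R p (realign τ z) :=
        Finset.sum_le_sum fun z _ => hpoint z
    _ = lam ^ n * c ^ N * ∑ p ∈ S, ∑ z, R p (realign τ z) := by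
        rw [← Finset.mul_sum, Finset.sum_comm]
    _ ≤ lam ^ n * c ^ N * ∑ p ∈ S, (1 : ℝ) :=
        mul_le_mul_of_nonneg_left (Finset.sum_le_sum hRsum) (by positivity)
    _ ≤ _ := by
        rw [Finset.sum_const, nsmul_eq_mul, mul_one]
        exact mul_le_mul_of_nonneg_left hcard (by positivity)

end Confusion

/-! ### Overlap of a product law with its rearrangement -/

section Overlap

variable {ι U W : Type} [Fintype ι] [DecidableEq ι] [Fintype U] [Fintype W]

/-- The overlap of the law of i.i.d. pairs `(uᵢ, wᵢ)` of law `Q` with the law obtained by letting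
the permutation `g` rearrange the second components. -/
noncomputable def overlap (Q : U → W → ℝ) (g : Equiv.Perm ι) : ℝ :=
  ∑ z : ι → U × W, min (∏ i, Q (z i).1 (z i).2) (∏ i, Q (z i).1 (z (g i)).2)

lemma sum_prod_eq_one {Q : U → W → ℝ} (hQ1 : ∑ u, ∑ w, Q u w = 1) :
    ∑ z : ι → U × W, ∏ i, Q (z i).1 (z i).2 = 1 := by
  have h := Finset.prod_univ_sum (fun _ : ι => (Finset.univ : Finset (U × W)))
    fun _ a => Q a.1 a.2
  rw [Fintype.piFinset_univ] at h
  rw [← h]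
  simp [Fintype.sum_prod_type, hQ1]

lemma overlap_one {Q : U → W → ℝ} (hQ1 : ∑ u, ∑ w, Q u w = 1) :
    overlap Q (1 : Equiv.Perm ι) = 1 := by
  simp only [overlap, Equiv.Perm.one_apply, min_self]
  exact sum_prod_eq_one hQ1

/-- Exchanges the restrictions of two tuples to the complement of `s`. -/
def exchange {V : Type} (s : Finset ι) : (ι → V) × (ι → V) ≃ (ι → V) × (ι → V) where
  toFun p := (s.piecewise p.1 p.2, s.piecewise p.2 p.1)
  invFun p := (s.piecewise p.1 p.2, s.piecewise p.2 p.1)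
  left_inv p := by
    ext i <;> by_cases h : i ∈ s <;> simp [h]
  right_inv p := by
    ext i <;> by_cases h : i ∈ s <;> simp [h]

/-- Overlaps are supermultiplicative over disjoint permutations. -/
lemma overlap_mul_le {Q : U → W → ℝ} (hQ : ∀ u w, 0 ≤ Q u w) (hQ1 : ∑ u, ∑ w, Q u w = 1)
    {σ τ : Equiv.Perm ι} (hd : σ.Disjoint τ) : overlap Q σ * overlap Q τ ≤ overlap Q (σ * τ) := by
  have hnn : ∀ (g : Equiv.Perm ι) (z : ι → U × W), 0 ≤ ∏ i, Q (z i).1 (z (g i)).2 :=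
    fun g z => Finset.prod_nonneg fun i _ => hQ _ _
  have hnn1 : ∀ z : ι → U × W, 0 ≤ ∏ i, Q (z i).1 (z i).2 := hnn 1
  let f : (ι → U × W) × (ι → U × W) → ℝ := fun p =>
    min (∏ i, Q (p.1 i).1 (p.1 i).2) (∏ i, Q (p.1 i).1 (p.1 ((σ * τ) i)).2) *
      ∏ i, Q (p.2 i).1 (p.2 i).2
  have key : ∀ p : (ι → U × W) × (ι → U × W),
      min (∏ i, Q (p.1 i).1 (p.1 i).2) (∏ i, Q (p.1 i).1 (p.1 (σ i)).2) *
        min (∏ i, Q (p.2 i).1 (p.2 i).2) (∏ i, Q (p.2 i).1 (p.2 (τ i)).2) ≤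
      f (exchange σ.support p) := by
    intro p
    set y := σ.support.piecewise p.1 p.2 with hy
    set y' := σ.support.piecewise p.2 p.1 with hy'
    change _ ≤ min (∏ i, Q (y i).1 (y i).2) (∏ i, Q (y i).1 (y ((σ * τ) i)).2) *
      ∏ i, Q (y' i).1 (y' i).2
    rw [min_mul_of_nonneg _ _ (hnn1 y')]
    have hA : (∏ i, Q (p.1 i).1 (p.1 i).2) * ∏ i, Q (p.2 i).1 (p.2 i).2 =
        (∏ i, Q (y i).1 (y i).2) * ∏ i, Q (y' i).1 (y' i).2 := by
      rw [← Finset.prod_mul_distrib, ← Finset.prod_mul_distrib]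
      refine Finset.prod_congr rfl fun i _ => ?_
      by_cases h : i ∈ σ.support <;> simp only [hy, hy', Finset.piecewise, h, if_true, if_false]
      exact mul_comm _ _
    have hB : (∏ i, Q (p.1 i).1 (p.1 (σ i)).2) * ∏ i, Q (p.2 i).1 (p.2 (τ i)).2 =
        (∏ i, Q (y i).1 (y ((σ * τ) i)).2) * ∏ i, Q (y' i).1 (y' i).2 := by
      rw [← Finset.prod_mul_distrib, ← Finset.prod_mul_distrib]
      refine Finset.prod_congr rfl fun i _ => ?_
      by_cases h : i ∈ σ.support
      · have hτ : τ i = i := (hd i).resolve_left (Equiv.Perm.mem_support.mp h)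
        have hσ : σ i ∈ σ.support := Equiv.Perm.apply_mem_support.mpr h
        simp only [hy, hy', Finset.piecewise, h, hσ, hτ, Equiv.Perm.mul_apply, if_true]
      · have hσi : σ i = i := Equiv.Perm.notMem_support.mp h
        have hτ : τ i ∉ σ.support := by
          rw [Equiv.Perm.notMem_support]
          rcases hd (τ i) with h' | h'
          · exact h'
          · rw [τ.injective h', hσi]
        simp only [hy, hy', Finset.piecewise, h, hτ, hσi, Equiv.Perm.mul_apply,
          Equiv.Perm.notMem_support.mp hτ, if_false]
        exact mul_comm _ _
    refine le_min ?_ ?_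
    · rw [← hA]
      exact mul_le_mul (min_le_left _ _) (min_le_left _ _) (le_min (hnn1 _) (hnn τ _)) (hnn1 _)
    · rw [← hB]
      exact mul_le_mul (min_le_right _ _) (min_le_right _ _) (le_min (hnn1 _) (hnn τ _))
        (hnn σ _)
  calc overlap Q σ * overlap Q τ = ∑ p : (ι → U × W) × (ι → U × W),
        min (∏ i, Q (p.1 i).1 (p.1 i).2) (∏ i, Q (p.1 i).1 (p.1 (σ i)).2) *
        min (∏ i, Q (p.2 i).1 (p.2 i).2) (∏ i, Q (p.2 i).1 (p.2 (τ i)).2) := by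
        rw [overlap, overlap, Finset.sum_mul_sum, Fintype.sum_prod_type]
    _ ≤ ∑ p, f (exchange σ.support p) := Finset.sum_le_sum fun p _ => key p
    _ = overlap Q (σ * τ) := by
        rw [Equiv.sum_comp (exchange σ.support) f, Fintype.sum_prod_type]
        simp only [f, ← Finset.mul_sum, sum_prod_eq_one hQ1, mul_one]
        rfl

/-- The overlap for the cyclic shift of `l` positions. -/
noncomputable def cyclicOverlap (Q : U → W → ℝ) (l : ℕ) : ℝ :=
  ∑ z : Fin l → U × W, min (∏ i, Q (z i).1 (z i).2) (∏ i, Q (z i).1 (z (finRotate l i)).2)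

lemma cyclicOverlap_le_overlap {Q : U → W → ℝ} (hQ : ∀ u w, 0 ≤ Q u w)
    (hQ1 : ∑ u, ∑ w, Q u w = 1) {g : Equiv.Perm ι} (hg : g.IsCycle) :
    cyclicOverlap Q g.support.card ≤ overlap Q g := by
  classical
  obtain ⟨a, ha⟩ := hg.nonempty_support
  set l := g.support.card with hl
  have hord : orderOf g = l := hg.orderOf
  have hl0 : 0 < l := Finset.card_pos.mpr ⟨a, ha⟩
  have hmem : ∀ i : ℕ, (g ^ i) a ∈ g.support := fun i => Equiv.Perm.pow_apply_mem_support.mpr ha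
  let f : Fin l → {i // i ∈ g.support} := fun i => ⟨(g ^ (i : ℕ)) a, hmem i⟩
  have hf : Function.Bijective f := by
    rw [Fintype.bijective_iff_injective_and_card]
    refine ⟨fun i j hij => ?_, by rw [Fintype.card_fin, Fintype.card_coe]⟩
    have h1 : (g ^ (i : ℕ)) a = (g ^ (j : ℕ)) a := congrArg Subtype.val hij
    have h2 := (hg.pow_eq_pow_iff).mpr ⟨a, Equiv.Perm.mem_support.mp ha, h1⟩
    have h3 := pow_injOn_Iio_orderOf (x := g) (x₁ := (i : ℕ)) (by simp [hord])
      (x₂ := (j : ℕ)) (by simp [hord]) h2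
    exact Fin.ext h3
  let e : Fin l ⊕ {i // i ∉ g.support} ≃ ι :=
    ((Equiv.ofBijective f hf).sumCongr (Equiv.refl _)).trans (Equiv.sumCompl (· ∈ g.support))
  have hel : ∀ i : Fin l, e (Sum.inl i) = (g ^ (i : ℕ)) a := fun i => rfl
  have her : ∀ j : {i // i ∉ g.support}, e (Sum.inr j) = j := fun j => rfl
  have hgl : ∀ i : Fin l, g (e (Sum.inl i)) = e (Sum.inl (finRotate l i)) := by
    intro i
    rw [hel, hel, ← Equiv.Perm.mul_apply, ← pow_succ']
    obtain ⟨l', hl'⟩ : ∃ l', l = l' + 1 := ⟨l - 1, by omega⟩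
    have hg1 : g ^ l = 1 := by rw [← hord]; exact pow_orderOf_eq_one g
    clear_value l
    subst hl'
    rw [coe_finRotate]
    split_ifs with hi
    · rw [hi, Fin.val_last, hg1, pow_zero]
    · rfl
  have hgr : ∀ j : {i // i ∉ g.support}, g (e (Sum.inr j)) = e (Sum.inr j) := fun j =>
    Equiv.Perm.notMem_support.mp j.2
  let E : (Fin l → U × W) × ({i // i ∉ g.support} → U × W) ≃ (ι → U × W) :=
    (Equiv.sumArrowEquivProdArrow _ _ _).symm.trans (e.arrowCongr (Equiv.refl _))
  have hEl : ∀ p i, E p (e (Sum.inl i)) = p.1 i := fun p i => by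
    change Sum.elim p.1 p.2 (e.symm (e (Sum.inl i))) = _
    rw [e.symm_apply_apply, Sum.elim_inl]
  have hEr : ∀ p j, E p (e (Sum.inr j)) = p.2 j := fun p j => by
    change Sum.elim p.1 p.2 (e.symm (e (Sum.inr j))) = _
    rw [e.symm_apply_apply, Sum.elim_inr]
  refine le_of_eq ?_
  rw [overlap, ← Equiv.sum_comp E, Fintype.sum_prod_type]
  have h : ∀ (x : Fin l → U × W) (y : {i // i ∉ g.support} → U × W),
      min (∏ i, Q (E (x, y) i).1 (E (x, y) i).2) (∏ i, Q (E (x, y) i).1 (E (x, y) (g i)).2) =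
      min (∏ i, Q (x i).1 (x i).2) (∏ i, Q (x i).1 (x (finRotate l i)).2) *
        ∏ j, Q (y j).1 (y j).2 := by
    intro x y
    rw [min_mul_of_nonneg _ _ (Finset.prod_nonneg fun j _ => hQ _ _)]
    rw [← Equiv.prod_comp e, ← Equiv.prod_comp e fun i => Q (E (x, y) i).1 (E (x, y) (g i)).2,
      Fintype.prod_sum_type, Fintype.prod_sum_type]
    simp only [hgl, hgr, hEl, hEr]
  simp only [h, ← Finset.mul_sum, sum_prod_eq_one hQ1, mul_one]
  rfl

/-- Lower bounds for cyclic shifts give lower bounds for all permutations, with one factor `κ`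
for each nontrivial cycle. -/
lemma pow_mul_pow_le_overlap {Q : U → W → ℝ} (hQ : ∀ u w, 0 ≤ Q u w)
    (hQ1 : ∑ u, ∑ w, Q u w = 1) {lam κ : ℝ} (hlam : 0 ≤ lam) (hκ : 0 ≤ κ)
    (h : ∀ l, 2 ≤ l → l ≤ Fintype.card ι → lam ^ l * κ ≤ cyclicOverlap Q l)
    (g : Equiv.Perm ι) :
    lam ^ g.support.card * κ ^ Multiset.card g.cycleType ≤ overlap Q g := by
  induction g using Equiv.Perm.cycle_induction_on with
  | base_one => simp [overlap_one hQ1]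
  | base_cycles σ hσ =>
    rw [hσ.cycleType, Multiset.card_singleton, pow_one]
    exact (h _ hσ.two_le_card_support (Finset.card_le_univ _)).trans
      (cyclicOverlap_le_overlap hQ hQ1 hσ)
  | induction_disjoint σ τ hd hc h1 h2 =>
    rw [hd.cycleType_mul, hd.card_support_mul, Multiset.card_add, pow_add, pow_add]
    calc _ = (lam ^ σ.support.card * κ ^ Multiset.card σ.cycleType) *
          (lam ^ τ.support.card * κ ^ Multiset.card τ.cycleType) := by ring
      _ ≤ overlap Q σ * overlap Q τ :=
          mul_le_mul h1 h2 (by positivity) ((by positivity : (0:ℝ) ≤ _).trans h1)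
      _ ≤ _ := overlap_mul_le hQ hQ1 hd

end Overlap

/-! ### Palindromic closed walks -/

section Walks

variable {U W : Type} [Fintype U] [Fintype W]

/-- A walk of `2 * m` steps in the complete bipartite graph on `W` and `U` that starts and ends in
`W`, given by the sequences of its vertices in `W` and in `U`. -/
abbrev Walk (U W : Type) (m : ℕ) : Type := (Fin (m + 1) → W) × (Fin m → U)

/-- The product of the weights of the edges of a walk that leave `W`. -/
noncomputable def Walk.outWeight (Q : U → W → ℝ) {m : ℕ} (p : Walk U W m) : ℝ :=
  ∏ i, Q (p.2 i) (p.1 i.castSucc)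

/-- The product of the weights of the edges of a walk that enter `W`. -/
noncomputable def Walk.inWeight (Q : U → W → ℝ) {m : ℕ} (p : Walk U W m) : ℝ :=
  ∏ i, Q (p.2 i) (p.1 i.succ)

/-- Weighting the last vertex by an eigenvector `b` of `KᵀK`, every pair of steps contributes a
factor `lam`. -/
lemma sum_walk_eigenvector {K : U → W → ℝ} {b : W → ℝ} {lam : ℝ}
    (hb : ∀ w, ∑ u, K u w * ∑ w', K u w' * b w' = lam * b w) (m : ℕ) (φ : W → ℝ) :
    ∑ w : Fin (m + 1) → W, ∑ u : Fin m → U, φ (w 0) *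
      (∏ i, K (u i) (w i.castSucc) * K (u i) (w i.succ)) * b (w (Fin.last m)) =
    lam ^ m * ∑ w, φ w * b w := by
  induction m generalizing φ with
  | zero =>
    rw [← Equiv.sum_comp (Equiv.funUnique (Fin 1) W).symm]
    simp
  | succ m ih =>
    rw [← Equiv.sum_comp (Fin.consEquiv fun _ => W), Fintype.sum_prod_type]
    have h1 : ∀ (w₀ : W) (w : Fin (m + 1) → W),
        ∑ u : Fin (m + 1) → U, φ ((Fin.consEquiv fun _ => W) (w₀, w) 0) *
          (∏ i, K (u i) ((Fin.consEquiv fun _ => W) (w₀, w) i.castSucc) *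
            K (u i) ((Fin.consEquiv fun _ => W) (w₀, w) i.succ)) *
            b ((Fin.consEquiv fun _ => W) (w₀, w) (Fin.last (m + 1))) =
        ∑ u₀, ∑ u : Fin m → U, φ w₀ * K u₀ w₀ * K u₀ (w 0) *
          (∏ i, K (u i) (w i.castSucc) * K (u i) (w i.succ)) * b (w (Fin.last m)) := by
      intro w₀ w
      rw [← Equiv.sum_comp (Fin.consEquiv fun _ => U), Fintype.sum_prod_type]
      refine Finset.sum_congr rfl fun u₀ _ => Finset.sum_congr rfl fun u _ => ?_
      rw [Fin.prod_univ_succ, ← Fin.succ_last]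
      simp only [Fin.consEquiv_apply, Fin.cons_zero, Fin.cons_succ, Fin.castSucc_zero,
        Fin.castSucc_succ]
      ring
    simp only [h1]
    have h2 := ih fun w => ∑ w₀, ∑ u₀, φ w₀ * K u₀ w₀ * K u₀ w
    simp only [Finset.sum_mul] at h2
    calc _ = ∑ w : Fin (m + 1) → W, ∑ u : Fin m → U, ∑ w₀, ∑ u₀,
          φ w₀ * K u₀ w₀ * K u₀ (w 0) *
          (∏ i, K (u i) (w i.castSucc) * K (u i) (w i.succ)) * b (w (Fin.last m)) := by
          rw [Finset.sum_comm]
          refine Finset.sum_congr rfl fun w _ => ?_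
          exact (Finset.sum_congr rfl fun w₀ _ => Finset.sum_comm).trans Finset.sum_comm
      _ = _ := h2
      _ = lam ^ m * ∑ w₀, φ w₀ * ∑ u, K u w₀ * ∑ w', K u w' * b w' := by
          congr 1
          rw [Finset.sum_comm]
          refine Finset.sum_congr rfl fun w₀ _ => ?_
          rw [Finset.sum_comm, Finset.mul_sum]
          refine Finset.sum_congr rfl fun u _ => ?_
          rw [Finset.mul_sum, Finset.mul_sum]
          exact Finset.sum_congr rfl fun _ _ => by ring
      _ = _ := by
          simp only [hb]
          rw [pow_succ, mul_assoc, Finset.mul_sum _ _ lam]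
          congr 1
          exact Finset.sum_congr rfl fun _ _ => by ring

lemma pow_le_sum_walk {Q : U → W → ℝ} (hQ : ∀ u w, 0 ≤ Q u w) {b : W → ℝ} {lam : ℝ}
    (hb0 : ∀ w, 0 ≤ b w) (hb1 : ∑ w, b w ^ 2 = 1)
    (hb : ∀ w, ∑ u, √(Q u w) * ∑ w', √(Q u w') * b w' = lam * b w) (m : ℕ) :
    lam ^ m ≤ ∑ p : Walk U W m, √(p.outWeight Q) * √(p.inWeight Q) := by
  have hble : ∀ w, b w ≤ 1 := by
    intro w
    have h : b w ^ 2 ≤ 1 := hb1 ▸ Finset.single_le_sum (f := fun w => b w ^ 2)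
      (fun _ _ => sq_nonneg _) (Finset.mem_univ w)
    exact (sq_le_one_iff₀ (hb0 w)).mp h
  have h := sum_walk_eigenvector hb m b
  have hb1' : ∑ w, b w * b w = 1 := by simpa only [sq] using hb1
  rw [hb1', mul_one] at h
  rw [← h, Fintype.sum_prod_type]
  refine Finset.sum_le_sum fun w _ => Finset.sum_le_sum fun u _ => ?_
  have hprod : √(Walk.outWeight Q (w, u)) * √(Walk.inWeight Q (w, u)) =
      ∏ i, √(Q (u i) (w i.castSucc)) * √(Q (u i) (w i.succ)) := by
    rw [Walk.outWeight, Walk.inWeight, Real.sqrt_eq_rpow, Real.sqrt_eq_rpow,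
      ← Real.finsetProd_rpow _ _ fun i _ => hQ _ _, ← Real.finsetProd_rpow _ _ fun i _ => hQ _ _,
      Finset.prod_mul_distrib]
    simp only [Real.sqrt_eq_rpow]
  have h0 : 0 ≤ √(Walk.outWeight Q (w, u)) * √(Walk.inWeight Q (w, u)) := by positivity
  rw [hprod] at h0 ⊢
  calc _ ≤ 1 * (∏ i, √(Q (u i) (w i.castSucc)) * √(Q (u i) (w i.succ))) * 1 :=
        mul_le_mul (mul_le_mul_of_nonneg_right (hble _) h0) (hble _) (hb0 _) (by rwa [one_mul])
    _ = _ := by ring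

variable [DecidableEq U] [DecidableEq W]

/-- The end points of a walk and the numbers of times it uses each edge in each direction. -/
def Walk.key {m : ℕ} (p : Walk U W m) :
    (W × W) × ((U × W → Fin (m + 1)) × (U × W → Fin (m + 1))) :=
  ((p.1 0, p.1 (Fin.last m)),
    (fun a => ⟨(Finset.univ.filter fun i => (p.2 i, p.1 i.castSucc) = a).card,
      Nat.lt_succ_of_le ((Finset.card_le_univ _).trans_eq (Fintype.card_fin m))⟩,
    fun a => ⟨(Finset.univ.filter fun i => (p.2 i, p.1 i.succ) = a).card,
      Nat.lt_succ_of_le ((Finset.card_le_univ _).trans_eq (Fintype.card_fin m))⟩))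

lemma prod_eq_prod_pow_card (Q : U → W → ℝ) {m : ℕ} (x : Fin m → U × W) :
    ∏ i, Q (x i).1 (x i).2 =
      ∏ a : U × W, Q a.1 a.2 ^ (Finset.univ.filter fun i => x i = a).card := by
  rw [← Finset.prod_fiberwise' Finset.univ x fun a => Q a.1 a.2]
  simp only [Finset.prod_const]

lemma Walk.outWeight_eq_of_key_eq (Q : U → W → ℝ) {m : ℕ} {p p' : Walk U W m}
    (h : p.key = p'.key) : p.outWeight Q = p'.outWeight Q := by
  have h1 : ∀ a, (Finset.univ.filter fun i => (p.2 i, p.1 i.castSucc) = a).card =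
      (Finset.univ.filter fun i => (p'.2 i, p'.1 i.castSucc) = a).card := fun a =>
    congrArg Fin.val (congrFun (congrArg (fun k => k.2.1) h) a)
  rw [Walk.outWeight, Walk.outWeight,
    prod_eq_prod_pow_card Q fun i => (p.2 i, p.1 i.castSucc),
    prod_eq_prod_pow_card Q fun i => (p'.2 i, p'.1 i.castSucc)]
  exact Finset.prod_congr rfl fun a _ => by rw [h1 a]

lemma Walk.inWeight_eq_of_key_eq (Q : U → W → ℝ) {m : ℕ} {p p' : Walk U W m}
    (h : p.key = p'.key) : p.inWeight Q = p'.inWeight Q := by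
  have h1 : ∀ a, (Finset.univ.filter fun i => (p.2 i, p.1 i.succ) = a).card =
      (Finset.univ.filter fun i => (p'.2 i, p'.1 i.succ) = a).card := fun a =>
    congrArg Fin.val (congrFun (congrArg (fun k => k.2.2) h) a)
  rw [Walk.inWeight, Walk.inWeight,
    prod_eq_prod_pow_card Q fun i => (p.2 i, p.1 i.succ),
    prod_eq_prod_pow_card Q fun i => (p'.2 i, p'.1 i.succ)]
  exact Finset.prod_congr rfl fun a _ => by rw [h1 a]

open Classical in
/-- Pairs of walks with the same key carry almost all the weight, by the Cauchy–Schwarz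
inequality. -/
lemma sq_sum_walk_le {Q : U → W → ℝ} (hQ : ∀ u w, 0 ≤ Q u w) (m : ℕ) :
    (∑ p : Walk U W m, √(p.outWeight Q) * √(p.inWeight Q)) ^ 2 ≤
      ((Fintype.card W : ℝ) ^ 2 * ((m + 1 : ℝ) ^ Fintype.card (U × W)) ^ 2) *
      ∑ p ∈ (Finset.univ : Finset (Walk U W m × Walk U W m)).filter fun p => p.1.key = p.2.key,
        p.1.outWeight Q * p.2.inWeight Q := by
  set ω : Walk U W m → ℝ := fun p => √(p.outWeight Q) * √(p.inWeight Q) with hω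
  rw [← Finset.sum_fiberwise Finset.univ Walk.key ω]
  refine sq_sum_le_card_mul_sum_sq.trans (le_of_eq ?_)
  congr 1
  · rw [Finset.card_univ]
    simp only [Fintype.card_prod, Fintype.card_fun, Fintype.card_fin]
    push_cast
    ring
  · rw [Finset.sum_filter]
    have h : ∀ κ, (∑ p ∈ Finset.univ.filter fun p : Walk U W m => p.key = κ, ω p) ^ 2 =
        ∑ p ∈ Finset.univ.filter fun p : Walk U W m => p.key = κ,
          ∑ p' : Walk U W m, if p.key = p'.key then p.outWeight Q * p'.inWeight Q else 0 := by
      intro κ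
      rw [sq, Finset.sum_mul_sum]
      refine Finset.sum_congr rfl fun p hp => ?_
      have hpκ : p.key = κ := (Finset.mem_filter.mp hp).2
      rw [← Finset.sum_filter]
      refine Finset.sum_congr (by ext; simp [hpκ, eq_comm]) fun p' hp' => ?_
      have hpp : p.key = p'.key := by
        rw [hpκ]; exact ((Finset.mem_filter.mp hp').2.symm.trans (by rw [hpκ])).symm
      have h1 : 0 ≤ p'.outWeight Q := Finset.prod_nonneg fun i _ => hQ _ _
      have h2 : 0 ≤ p'.inWeight Q := Finset.prod_nonneg fun i _ => hQ _ _
      simp only [hω, Walk.outWeight_eq_of_key_eq Q hpp, Walk.inWeight_eq_of_key_eq Q hpp]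
      calc _ = (√(p'.outWeight Q) * √(p'.outWeight Q)) *
            (√(p'.inWeight Q) * √(p'.inWeight Q)) := by ring
        _ = _ := by rw [Real.mul_self_sqrt h1, Real.mul_self_sqrt h2]
    simp only [h]
    refine (Finset.sum_fiberwise Finset.univ Walk.key fun p : Walk U W m =>
      ∑ p' : Walk U W m, if p.key = p'.key then p.outWeight Q * p'.inWeight Q else 0).trans ?_
    rw [Fintype.sum_prod_type (f := fun p : Walk U W m × Walk U W m =>
      if p.1.key = p.2.key then p.1.outWeight Q * p.2.inWeight Q else 0)]

end Walks

section Glue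

lemma val_finRotate {l : ℕ} (i : Fin l) :
    (finRotate l i : ℕ) = if (i : ℕ) + 1 = l then 0 else (i : ℕ) + 1 := by
  cases l with
  | zero => exact i.elim0
  | succ l =>
    rw [coe_finRotate]
    simp only [Fin.ext_iff, Fin.val_last, Nat.add_right_cancel_iff]

variable {U W : Type} [Fintype U] [Fintype W] {m : ℕ} [NeZero m]

/-- The `W`-vertex at position `i` of the closed walk that waits for `s` rounds at the initial
vertex, follows `p`, and returns along `p'`. -/
def glueW (s : ℕ) (p p' : Walk U W m) (i : ℕ) : W :=
  if i < s then p.1 (Fin.ofNat (m + 1) 0) else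
    if i < s + m then p.1 (Fin.ofNat (m + 1) (i - s)) else
      p'.1 (Fin.ofNat (m + 1) (s + (m + m) - i))

/-- The `U`-vertex between the positions `i` and `i + 1` of the closed walk that waits for `s`
rounds at the initial vertex, follows `p`, and returns along `p'`. -/
def glueU (s : ℕ) (p p' : Walk U W m) (i : ℕ) : U :=
  if i < s then p.2 (Fin.ofNat m 0) else
    if i < s + m then p.2 (Fin.ofNat m (i - s)) else
      p'.2 (Fin.ofNat m (s + (m + m) - 1 - i))

lemma Walk.outWeight_eq_prod_range (Q : U → W → ℝ) (p : Walk U W m) :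
    p.outWeight Q =
      ∏ i ∈ Finset.range m, Q (p.2 (Fin.ofNat m i)) (p.1 (Fin.ofNat (m + 1) i)) := by
  rw [Finset.prod_range, Walk.outWeight]
  refine Finset.prod_congr rfl fun i _ => ?_
  rw [Fin.ofNat_val_eq_self, show Fin.ofNat (m + 1) (i : ℕ) = i.castSucc from
    Fin.ext (Nat.mod_eq_of_lt (by omega))]

lemma Walk.inWeight_eq_prod_range (Q : U → W → ℝ) (p : Walk U W m) :
    p.inWeight Q =
      ∏ i ∈ Finset.range m, Q (p.2 (Fin.ofNat m i)) (p.1 (Fin.ofNat (m + 1) (i + 1))) := by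
  rw [Finset.prod_range, Walk.inWeight]
  refine Finset.prod_congr rfl fun i _ => ?_
  rw [Fin.ofNat_val_eq_self, show Fin.ofNat (m + 1) ((i : ℕ) + 1) = i.succ from
    Fin.ext (Nat.mod_eq_of_lt (by omega))]

lemma prod_glue_out (Q : U → W → ℝ) (s : ℕ) (p p' : Walk U W m) :
    ∏ i ∈ Finset.range (s + (m + m)), Q (glueU s p p' i) (glueW s p p' i) =
      Q (p.2 (Fin.ofNat m 0)) (p.1 (Fin.ofNat (m + 1) 0)) ^ s *
        (p.outWeight Q * p'.inWeight Q) := by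
  rw [Finset.prod_range_add, Finset.prod_range_add, Walk.outWeight_eq_prod_range,
    Walk.inWeight_eq_prod_range,
    ← Finset.prod_range_reflect fun i =>
      Q (p'.2 (Fin.ofNat m i)) (p'.1 (Fin.ofNat (m + 1) (i + 1)))]
  congr 1
  · refine (Finset.prod_congr rfl fun i hi => ?_).trans
      ((Finset.prod_const _).trans (by rw [Finset.card_range]))
    have := Finset.mem_range.mp hi
    simp [glueU, glueW, this]
  congr 1
  · refine Finset.prod_congr rfl fun i hi => ?_
    have hi := Finset.mem_range.mp hi
    simp [glueU, glueW, hi]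
  · refine Finset.prod_congr rfl fun i hi => ?_
    have hi := Finset.mem_range.mp hi
    have h1 : ¬ s + (m + i) < s := by omega
    have h2 : ¬ s + (m + i) < s + m := by omega
    simp only [glueU, glueW, h1, h2, if_false]
    rw [show s + (m + m) - 1 - (s + (m + i)) = m - 1 - i by omega,
      show s + (m + m) - (s + (m + i)) = m - 1 - i + 1 by omega]

lemma prod_glue_in (Q : U → W → ℝ) (s : ℕ) {p p' : Walk U W m}
    (hlast : p.1 (Fin.ofNat (m + 1) m) = p'.1 (Fin.ofNat (m + 1) m)) :
    ∏ i ∈ Finset.range (s + (m + m)), Q (glueU s p p' i) (glueW s p p' (i + 1)) =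
      Q (p.2 (Fin.ofNat m 0)) (p.1 (Fin.ofNat (m + 1) 0)) ^ s *
        (p.inWeight Q * p'.outWeight Q) := by
  have hm : 0 < m := Nat.pos_of_ne_zero (NeZero.ne m)
  rw [Finset.prod_range_add, Finset.prod_range_add, Walk.inWeight_eq_prod_range,
    Walk.outWeight_eq_prod_range,
    ← Finset.prod_range_reflect fun i => Q (p'.2 (Fin.ofNat m i)) (p'.1 (Fin.ofNat (m + 1) i))]
  congr 1
  · refine (Finset.prod_congr rfl fun i hi => ?_).trans
      ((Finset.prod_const _).trans (by rw [Finset.card_range]))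
    have hi := Finset.mem_range.mp hi
    have h1 : i + 1 < s + m := by omega
    have h2 : i + 1 - s = 0 ∨ i + 1 < s := by omega
    rcases h2 with h2 | h2 <;> simp [glueU, glueW, hi, h1, h2]
  congr 1
  · refine Finset.prod_congr rfl fun i hi => ?_
    have hi := Finset.mem_range.mp hi
    have h1 : ¬ s + i < s := by omega
    have h2 : ¬ s + i + 1 < s := by omega
    have h3 : s + i < s + m := by omega
    simp only [glueU, glueW, h1, h2, h3, if_false, if_true, Nat.add_sub_cancel_left]
    congr 1
    split_ifs with h4
    · rw [show s + i + 1 - s = i + 1 by omega]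
    · rw [show i + 1 = m by omega, hlast, show s + (m + m) - (s + i + 1) = m by omega]
  · refine Finset.prod_congr rfl fun i hi => ?_
    have hi := Finset.mem_range.mp hi
    have h1 : ¬ s + (m + i) < s := by omega
    have h2 : ¬ s + (m + i) < s + m := by omega
    have h3 : ¬ s + (m + i) + 1 < s := by omega
    have h4 : ¬ s + (m + i) + 1 < s + m := by omega
    simp only [glueU, glueW, h1, h2, h3, h4, if_false]
    rw [show s + (m + m) - 1 - (s + (m + i)) = m - 1 - i by omega,
      show s + (m + m) - (s + (m + i) + 1) = m - 1 - i by omega]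

lemma glueW_last {s : ℕ} {p p' : Walk U W m}
    (hzero : p.1 (Fin.ofNat (m + 1) 0) = p'.1 (Fin.ofNat (m + 1) 0)) :
    glueW s p p' (s + (m + m)) = glueW s p p' 0 := by
  have hm : 0 < m := Nat.pos_of_ne_zero (NeZero.ne m)
  have h1 : ¬ s + (m + m) < s := by omega
  have h2 : ¬ s + (m + m) < s + m := by omega
  have h3 : 0 < s + m := by omega
  simp only [glueW, h1, h2, h3, if_false, if_true, Nat.sub_self, Nat.zero_sub, ite_self, hzero]

lemma Walk.ext_ofNat {p q : Walk U W m}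
    (hw : ∀ i ≤ m, p.1 (Fin.ofNat (m + 1) i) = q.1 (Fin.ofNat (m + 1) i))
    (hu : ∀ i < m, p.2 (Fin.ofNat m i) = q.2 (Fin.ofNat m i)) : p = q := by
  refine Prod.ext (funext fun i => ?_) (funext fun i => ?_)
  · simpa [Fin.ofNat_val_eq_self] using hw i (by omega)
  · simpa [Fin.ofNat_val_eq_self] using hu i i.2

/-- Two walks with the same end points can be recovered from the closed walk they form. -/
lemma glue_injective {s : ℕ} {p p' q q' : Walk U W m}
    (hp0 : p.1 (Fin.ofNat (m + 1) 0) = p'.1 (Fin.ofNat (m + 1) 0))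
    (hpm : p.1 (Fin.ofNat (m + 1) m) = p'.1 (Fin.ofNat (m + 1) m))
    (hq0 : q.1 (Fin.ofNat (m + 1) 0) = q'.1 (Fin.ofNat (m + 1) 0))
    (hqm : q.1 (Fin.ofNat (m + 1) m) = q'.1 (Fin.ofNat (m + 1) m))
    (hU : ∀ i < s + (m + m), glueU s p p' i = glueU s q q' i)
    (hW : ∀ i < s + (m + m), glueW s p p' i = glueW s q q' i) : p = q ∧ p' = q' := by
  have hm : 0 < m := Nat.pos_of_ne_zero (NeZero.ne m)
  have hw : ∀ i < m, p.1 (Fin.ofNat (m + 1) i) = q.1 (Fin.ofNat (m + 1) i) := by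
    intro i hi
    have := hW (s + i) (by omega)
    simpa [glueW, hi] using this
  have hu : ∀ i < m, p.2 (Fin.ofNat m i) = q.2 (Fin.ofNat m i) := by
    intro i hi
    have := hU (s + i) (by omega)
    simpa [glueU, hi] using this
  have hw' : ∀ i, 0 < i → i ≤ m → p'.1 (Fin.ofNat (m + 1) i) = q'.1 (Fin.ofNat (m + 1) i) := by
    intro i hi0 hi
    have := hW (s + (m + m) - i) (by omega)
    have h1 : ¬ s + (m + m) - i < s := by omega
    have h2 : ¬ s + (m + m) - i < s + m := by omega
    have h3 : s + (m + m) - (s + (m + m) - i) = i := by omega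
    simpa only [glueW, h1, h2, h3, if_false] using this
  have hu' : ∀ i < m, p'.2 (Fin.ofNat m i) = q'.2 (Fin.ofNat m i) := by
    intro i hi
    have := hU (s + (m + m) - 1 - i) (by omega)
    have h1 : ¬ s + (m + m) - 1 - i < s := by omega
    have h2 : ¬ s + (m + m) - 1 - i < s + m := by omega
    have h3 : s + (m + m) - 1 - (s + (m + m) - 1 - i) = i := by omega
    simpa only [glueU, h1, h2, h3, if_false] using this
  refine ⟨Walk.ext_ofNat (fun i hi => ?_) hu, Walk.ext_ofNat (fun i hi => ?_) hu'⟩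
  · rcases hi.lt_or_eq with h | h
    · exact hw i h
    · rw [h, hpm, hqm, hw' m hm le_rfl]
  · rcases Nat.eq_zero_or_pos i with h | h
    · rw [h, ← hp0, ← hq0, hw 0 hm]
    · exact hw' i h hi

variable [DecidableEq U] [DecidableEq W]

open Classical in
/-- For pairs of walks with the same key, the closed walk formed by them has the same product of
weights in both directions.  The `s` rounds of waiting use the first edge of the first walk, whose
weight is at least `q`. -/
lemma sum_pairs_le_cyclicOverlap {Q : U → W → ℝ} (hQ : ∀ u w, 0 ≤ Q u w) {q : ℝ} (hq0 : 0 ≤ q)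
    (hq : ∀ u w, Q u w ≠ 0 → q ≤ Q u w) (s : ℕ) :
    q ^ s * ∑ p ∈ (Finset.univ : Finset (Walk U W m × Walk U W m)).filter
      fun p => p.1.key = p.2.key, p.1.outWeight Q * p.2.inWeight Q ≤
      cyclicOverlap Q (s + (m + m)) := by
  have hm : 0 < m := Nat.pos_of_ne_zero (NeZero.ne m)
  set S := (Finset.univ : Finset (Walk U W m × Walk U W m)).filter
      fun p => p.1.key = p.2.key with hS
  have hkey : ∀ p ∈ S, p.1.key = p.2.key := fun p hp => (Finset.mem_filter.mp hp).2
  have hzero : ∀ p ∈ S, p.1.1 (Fin.ofNat (m + 1) 0) = p.2.1 (Fin.ofNat (m + 1) 0) :=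
    fun p hp => congrArg (fun k => k.1.1) (hkey p hp)
  have hofm : Fin.ofNat (m + 1) m = Fin.last m := Fin.ext (Nat.mod_eq_of_lt (by omega))
  have hlast : ∀ p ∈ S, p.1.1 (Fin.ofNat (m + 1) m) = p.2.1 (Fin.ofNat (m + 1) m) := by
    intro p hp
    rw [hofm]
    exact congrArg (fun k => k.1.2) (hkey p hp)
  let φ : Walk U W m × Walk U W m → Fin (s + (m + m)) → U × W := fun p i =>
    (glueU s p.1 p.2 i, glueW s p.1 p.2 i)
  have hφ : Set.InjOn φ S := by
    intro p hp p' hp' h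
    have h' := glue_injective (hzero p hp) (hlast p hp) (hzero p' hp') (hlast p' hp')
      (fun i hi => congrArg Prod.fst (congrFun h ⟨i, hi⟩))
      (fun i hi => congrArg Prod.snd (congrFun h ⟨i, hi⟩))
    exact Prod.ext h'.1 h'.2
  set f : (Fin (s + (m + m)) → U × W) → ℝ := fun z =>
    min (∏ i, Q (z i).1 (z i).2) (∏ i, Q (z i).1 (z (finRotate _ i)).2) with hf
  have hf0 : ∀ z, 0 ≤ f z := fun z =>
    le_min (Finset.prod_nonneg fun _ _ => hQ _ _) (Finset.prod_nonneg fun _ _ => hQ _ _)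
  have hnn : ∀ p : Walk U W m, 0 ≤ p.outWeight Q ∧ 0 ≤ p.inWeight Q := fun p =>
    ⟨Finset.prod_nonneg fun _ _ => hQ _ _, Finset.prod_nonneg fun _ _ => hQ _ _⟩
  have hpoint : ∀ p ∈ S, q ^ s * (p.1.outWeight Q * p.2.inWeight Q) ≤ f (φ p) := by
    intro p hp
    have h1 : ∏ i, Q (φ p i).1 (φ p i).2 = Q (p.1.2 (Fin.ofNat m 0)) (p.1.1 (Fin.ofNat (m + 1) 0))
        ^ s * (p.1.outWeight Q * p.2.inWeight Q) := by
      rw [← prod_glue_out, Finset.prod_range]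
    have hrot : ∀ i, (φ p (finRotate _ i)).2 = glueW s p.1 p.2 (i + 1) := by
      intro i
      change glueW s p.1 p.2 (finRotate _ i : Fin _) = _
      rw [val_finRotate]
      split_ifs with h
      · rw [h, glueW_last (hzero p hp)]
      · rfl
    have h2 : ∏ i, Q (φ p i).1 (φ p (finRotate _ i)).2 =
        Q (p.1.2 (Fin.ofNat m 0)) (p.1.1 (Fin.ofNat (m + 1) 0)) ^ s *
          (p.1.outWeight Q * p.2.inWeight Q) := by
      simp only [hrot]
      rw [Walk.outWeight_eq_of_key_eq Q (hkey p hp), ← Walk.inWeight_eq_of_key_eq Q (hkey p hp),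
        mul_comm (p.2.outWeight Q), ← prod_glue_in Q s (hlast p hp), Finset.prod_range]
    rw [hf]
    simp only [h1, h2, min_self]
    rcases (hnn p.1).1.eq_or_lt with h | h
    · rw [← h, zero_mul, mul_zero, mul_zero]
    · refine mul_le_mul_of_nonneg_right (pow_le_pow_left₀ hq0 (hq _ _ fun h0 => h.ne' ?_) s)
        (mul_nonneg (hnn _).1 (hnn _).2)
      rw [Walk.outWeight_eq_prod_range]
      exact Finset.prod_eq_zero (Finset.mem_range.mpr hm) h0
  calc _ = ∑ p ∈ S, q ^ s * (p.1.outWeight Q * p.2.inWeight Q) := Finset.mul_sum _ _ _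
    _ ≤ ∑ p ∈ S, f (φ p) := Finset.sum_le_sum hpoint
    _ = ∑ z ∈ S.image φ, f z := (Finset.sum_image hφ).symm
    _ ≤ ∑ z, f z := Finset.sum_le_sum_of_subset_of_nonneg (Finset.subset_univ _)
        fun z _ _ => hf0 z
    _ = _ := rfl

end Glue

section Bound

variable {U W : Type} [Fintype U] [Fintype W]

/-- Cyclic shifts of length `l` have overlap at least `lam ^ l`, up to a polynomial factor. -/
lemma pow_mul_le_cyclicOverlap {Q : U → W → ℝ} (hQ : ∀ u w, 0 ≤ Q u w) {b : W → ℝ} {lam : ℝ}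
    (hlam0 : 0 ≤ lam) (hlam1 : lam ≤ 1)
    (hb0 : ∀ w, 0 ≤ b w) (hb1 : ∑ w, b w ^ 2 = 1)
    (hb : ∀ w, ∑ u, √(Q u w) * ∑ w', √(Q u w') * b w' = lam * b w)
    {q : ℝ} (hq0 : 0 ≤ q) (hq1 : q ≤ 1) (hq : ∀ u w, Q u w ≠ 0 → q ≤ Q u w)
    {n l : ℕ} (hl : 2 ≤ l) (hln : l ≤ n) :
    lam ^ l * (q / ((Fintype.card W : ℝ) ^ 2 * ((n + 1 : ℝ) ^ Fintype.card (U × W)) ^ 2)) ≤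
      cyclicOverlap Q l := by
  classical
  -- for odd `l` the closed walk waits for one round
  obtain ⟨s, m, hs, hm, rfl⟩ : ∃ s m, s ≤ 1 ∧ 0 < m ∧ l = s + (m + m) :=
    ⟨l % 2, l / 2, by omega, by omega, by omega⟩
  have : NeZero m := ⟨hm.ne'⟩
  have hW : (0 : ℝ) < Fintype.card W := by
    rcases isEmpty_or_nonempty W with h | h
    · simp at hb1
    · exact_mod_cast Fintype.card_pos
  set D := Fintype.card (U × W)
  have hC : 0 < (Fintype.card W : ℝ) ^ 2 * ((n + 1 : ℝ) ^ D) ^ 2 := by positivity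
  set X := ∑ p ∈ (Finset.univ : Finset (Walk U W m × Walk U W m)).filter
    fun p => p.1.key = p.2.key, p.1.outWeight Q * p.2.inWeight Q with hX
  have h1 : (lam ^ m) ^ 2 ≤ ((Fintype.card W : ℝ) ^ 2 * ((m + 1 : ℝ) ^ D) ^ 2) * X :=
    (pow_le_pow_left₀ (by positivity) (pow_le_sum_walk hQ hb0 hb1 hb m) 2).trans
      (sq_sum_walk_le hQ m)
  have hX0 : 0 ≤ X := Finset.sum_nonneg fun p _ =>
    mul_nonneg (Finset.prod_nonneg fun _ _ => hQ _ _) (Finset.prod_nonneg fun _ _ => hQ _ _)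
  have h2 : lam ^ (s + (m + m)) ≤ (Fintype.card W : ℝ) ^ 2 * ((n + 1 : ℝ) ^ D) ^ 2 * X := by
    calc lam ^ (s + (m + m)) ≤ lam ^ (m + m) := pow_le_pow_of_le_one hlam0 hlam1 (by omega)
      _ = (lam ^ m) ^ 2 := by rw [pow_add, sq]
      _ ≤ _ := h1
      _ ≤ _ := by
          have : (m : ℝ) ≤ n := by exact_mod_cast (by omega : m ≤ n)
          gcongr
  calc _ = q * (lam ^ (s + (m + m)) / ((Fintype.card W : ℝ) ^ 2 * ((n + 1 : ℝ) ^ D) ^ 2)) := by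
        ring
    _ ≤ q * X := mul_le_mul_of_nonneg_left (by rwa [div_le_iff₀' hC]) hq0
    _ ≤ q ^ s * X := mul_le_mul_of_nonneg_right
        (by simpa using pow_le_pow_of_le_one hq0 hq1 hs) hX0
    _ ≤ _ := sum_pairs_le_cyclicOverlap hQ hq0 hq s

end Bound

/-! ### Error bounds for a fixed number of pixels -/

section Gain

variable {J F : Type} [Fintype J] [DecidableEq J] [Fintype F] [DecidableEq F]

lemma GainBound.mono {Q : (J → F) → ℝ} {lam lam' : ℝ} {B : Finset J} (h : GainBound Q lam B)
    (hle : lam ≤ lam') : GainBound Q lam' B := fun α β =>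
  (h α β).trans (mul_le_mul_of_nonneg_right (Real.sqrt_le_sqrt hle) (by positivity))

lemma GainBound.pos {Q : (J → F) → ℝ} (hQ1 : ∑ a, Q a = 1) {lam : ℝ}
    {B : Finset J} (h : GainBound Q lam B) : 0 < lam := by
  obtain ⟨a, ha⟩ : ∃ a, 0 < Q a := by
    by_contra! hne
    have : ∑ a, Q a ≤ 0 := Finset.sum_nonpos fun a _ => hne a
    linarith
  set u₀ : {j // j ∉ B} → F := fun j => a j with hu₀
  set w₀ : {j // j ∈ B} → F := fun j => a j with hw₀
  have h1 := h (Pi.single u₀ 1) (Pi.single w₀ 1)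
  have h2 : ∑ u, ∑ w, √(Q (merge B w u)) * (Pi.single u₀ 1 : ({j // j ∉ B} → F) → ℝ) u
      * (Pi.single w₀ 1 : ({j // j ∈ B} → F) → ℝ) w = √(Q a) := by
    rw [Finset.sum_eq_single u₀ (fun u _ hu => by simp [hu]) (by simp),
      Finset.sum_eq_single w₀ (fun w _ hw => by simp [hw]) (by simp), hu₀, hw₀, merge_restrict]
    simp
  have h3 : ∀ {X : Type} [Fintype X] [DecidableEq X] (x : X),
      ∑ u, (Pi.single x 1 : X → ℝ) u ^ 2 = 1 := by
    intro X _ _ x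
    simp [Pi.single_apply]
  rw [h2, h3, h3, Real.sqrt_one, one_mul, mul_one] at h1
  exact Real.sqrt_pos.mp ((Real.sqrt_pos.mpr ha).trans_le h1)

end Gain

lemma eigenvalue_le_one {U W : Type} [Fintype U] [Fintype W] {Q : U → W → ℝ}
    (hQ : ∀ u w, 0 ≤ Q u w) (hQ1 : ∑ u, ∑ w, Q u w = 1) {b : W → ℝ} {lam : ℝ}
    (hb1 : ∑ w, b w ^ 2 = 1)
    (hb : ∀ w, ∑ u, √(Q u w) * ∑ w', √(Q u w') * b w' = lam * b w) : lam ≤ 1 := by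
  calc lam = ∑ w, b w * (lam * b w) := by
        have h : ∀ w, b w * (lam * b w) = lam * b w ^ 2 := fun w => by ring
        simp only [h, ← Finset.mul_sum, hb1, mul_one]
    _ = ∑ u, (∑ w, √(Q u w) * b w) ^ 2 := by
        simp only [← hb, Finset.mul_sum]
        rw [Finset.sum_comm]
        refine Finset.sum_congr rfl fun u _ => ?_
        rw [sq, Finset.sum_mul_sum]
        exact Finset.sum_congr rfl fun _ _ => Finset.sum_congr rfl fun _ _ => by ring
    _ ≤ ∑ u, (∑ w, √(Q u w) ^ 2) * ∑ w, b w ^ 2 :=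
        Finset.sum_le_sum fun u _ => Finset.sum_mul_sq_le_sq_mul_sq _ _ _
    _ = 1 := by simp only [hb1, mul_one, Real.sq_sqrt (hQ _ _), hQ1]

lemma exists_pos_lower_bound {A : Type} [Fintype A] {Q : A → ℝ} (hQ : ∀ a, 0 ≤ Q a)
    (hQ1 : ∑ a, Q a = 1) : ∃ q, 0 < q ∧ q ≤ 1 ∧ ∀ a, Q a ≠ 0 → q ≤ Q a := by
  classical
  have hne : (Finset.univ.filter fun a => Q a ≠ 0).Nonempty := by
    by_contra h
    rw [Finset.not_nonempty_iff_eq_empty, Finset.filter_eq_empty_iff] at h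
    have : ∑ a, Q a = 0 := Finset.sum_eq_zero fun a ha => not_not.mp (h ha)
    linarith
  obtain ⟨a, ha, hmin⟩ := Finset.exists_min_image _ Q hne
  refine ⟨Q a, (hQ a).lt_of_ne' (Finset.mem_filter.mp ha).2, ?_, fun a' ha' =>
    hmin a' (Finset.mem_filter.mpr ⟨Finset.mem_univ _, ha'⟩)⟩
  rw [← hQ1]
  exact Finset.single_le_sum (f := Q) (fun _ _ => hQ _) (Finset.mem_univ a)

section Rules

variable {n r k : ℕ} {G : Subgroup (Equiv.Perm (Fin n))}

/-- The misalignment `τ` of the noisy images, together with the trivial one of the source. -/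
def withSource (τ : Fin k → G) : Fin (k + 1) → Equiv.Perm (Fin n) :=
  Fin.cons 1 fun j => (τ j : Equiv.Perm (Fin n))

lemma stack_align (x : Image n r) (y : Fin k → Image n r) (τ : Fin k → G) :
    stack x (align τ y) = realign (withSource τ) (stack x y) := by
  funext i j
  refine Fin.cases ?_ (fun j => ?_) j <;> simp [stack, align, realign, withSource, transform]

/-- Misaligning a set `B` of components by a common permutation gives the overlap of the law on
the pairs of the other components and the components in `B`. -/
lemma sum_min_realign_eq_overlap {J F : Type} [Fintype J] [DecidableEq J] [Fintype F]
    [DecidableEq F] (Q : (J → F) → ℝ) (B : Finset J) (g : Equiv.Perm (Fin n))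
    {τ : J → Equiv.Perm (Fin n)} (hτ : ∀ j, τ j = if j ∈ B then g else 1) :
    ∑ z : Fin n → J → F, min (∏ i, Q (z i)) (∏ i, Q (realign τ z i)) =
      overlap (fun u w => Q (merge B w u)) g := by
  symm
  refine Fintype.sum_equiv ((Equiv.refl (Fin n)).arrowCongr ((Equiv.prodComm _ _).trans
    (Equiv.piEquivPiSubtypeProd (fun j => j ∈ B) fun _ => F).symm)) _ _ fun z => ?_
  have h1 : ∀ i, ((Equiv.refl (Fin n)).arrowCongr ((Equiv.prodComm _ _).trans
      (Equiv.piEquivPiSubtypeProd (fun j => j ∈ B) fun _ => F).symm)) z i =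
      merge B (z i).2 (z i).1 := fun i => rfl
  have h2 : ∀ i, realign τ (((Equiv.refl (Fin n)).arrowCongr ((Equiv.prodComm _ _).trans
      (Equiv.piEquivPiSubtypeProd (fun j => j ∈ B) fun _ => F).symm)) z) i =
      merge B (z (g i)).2 (z i).1 := by
    intro i
    funext j
    rw [realign, h1, hτ]
    by_cases hj : j ∈ B
    · rw [if_pos hj, merge_apply_mem _ _ _ hj, merge_apply_mem _ _ _ hj]
    · rw [if_neg hj, merge_apply_notMem _ _ _ hj, merge_apply_notMem _ _ _ hj]; rfl
  simp only [h1, h2]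

lemma half_overlap_pixelLaw_le_errorProb {P : Fin r → ℝ} {W : Fin r → (Fin k → Fin r) → ℝ}
    (hP : ∀ a, 0 ≤ P a) (hW : ∀ a v, 0 ≤ W a v) (Φ : Rule r k G) {B : Finset (Fin (k + 1))}
    (h0 : 0 ∉ B) (hB : B.Nonempty) {g : Equiv.Perm (Fin n)} (hg : g ∈ G) (hg1 : g ≠ 1) :
    1 / 2 * overlap (fun u w => pixelLaw P W (merge B w u)) g ≤ errorProb P W Φ := by
  let τ : Fin k → G := fun j => if j.succ ∈ B then ⟨g, hg⟩ else 1
  have hτ : ∀ j, withSource τ j = if j ∈ B then g else 1 := by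
    intro j
    refine Fin.cases ?_ (fun j => ?_) j
    · simp [withSource, h0]
    · simp only [withSource, Fin.cons_succ, τ]
      split_ifs <;> rfl
  have hne : τ ≠ 1 := by
    obtain ⟨j, hj⟩ := hB
    obtain ⟨j, rfl⟩ := Fin.exists_succ_eq.mpr (fun h : j = 0 => h0 (h ▸ hj))
    intro h
    have h1 := congrFun h j
    simp only [τ, if_pos hj] at h1
    exact hg1 (congrArg Subtype.val h1)
  refine le_trans (le_of_eq ?_) (half_overlap_le_errorProb hP hW Φ hne)
  rw [← sum_min_realign_eq_overlap _ B g hτ, ← sum_stack]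
  simp only [jointWeight_eq_prod, stack_align]

/-- Every rule errs with probability at least `lam ^ n`, up to a polynomial factor for each cycle of
a nontrivial element `g` of the group. -/
lemma pow_mul_pow_le_errorProb {P : Fin r → ℝ} {W : Fin r → (Fin k → Fin r) → ℝ}
    (hP : ∀ a, 0 ≤ P a) (hW : ∀ a v, 0 ≤ W a v) (hQ1 : ∑ a, pixelLaw P W a = 1)
    (Φ : Rule r k G) {B : Finset (Fin (k + 1))}
    (h0 : 0 ∉ B) (hB : B.Nonempty) {g : Equiv.Perm (Fin n)} (hg : g ∈ G) (hg1 : g ≠ 1)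
    {b : ({j // j ∈ B} → Fin r) → ℝ} {lam : ℝ} (hlam0 : 0 ≤ lam)
    (hb0 : ∀ w, 0 ≤ b w) (hb1 : ∑ w, b w ^ 2 = 1)
    (hb : ∀ w, ∑ u, √(pixelLaw P W (merge B w u)) * ∑ w', √(pixelLaw P W (merge B w' u)) * b w' =
      lam * b w)
    {q : ℝ} (hq0 : 0 ≤ q) (hq1 : q ≤ 1) (hq : ∀ a, pixelLaw P W a ≠ 0 → q ≤ pixelLaw P W a) :
    lam ^ n * (1 / 2 * (q / ((Fintype.card ({j // j ∈ B} → Fin r) : ℝ) ^ 2 *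
      ((n + 1 : ℝ) ^ Fintype.card (({j // j ∉ B} → Fin r) × ({j // j ∈ B} → Fin r))) ^ 2)) ^
      Multiset.card g.cycleType) ≤ errorProb P W Φ := by
  set Q : ({j // j ∉ B} → Fin r) → ({j // j ∈ B} → Fin r) → ℝ :=
    fun u w => pixelLaw P W (merge B w u) with hQdef
  have hQ : ∀ u w, 0 ≤ Q u w := fun u w => pixelLaw_nonneg hP hW _
  have hQ1' : ∑ u, ∑ w, Q u w = 1 := by
    rw [Finset.sum_comm, ← sum_merge B fun a => pixelLaw P W a, hQ1]
  have hlam1 : lam ≤ 1 := eigenvalue_le_one hQ hQ1' hb1 hb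
  set κ := q / ((Fintype.card ({j // j ∈ B} → Fin r) : ℝ) ^ 2 *
      ((n + 1 : ℝ) ^ Fintype.card (({j // j ∉ B} → Fin r) × ({j // j ∈ B} → Fin r))) ^ 2) with hκ
  have hκ0 : 0 ≤ κ := by positivity
  have h1 : lam ^ g.support.card * κ ^ Multiset.card g.cycleType ≤ overlap Q g :=
    pow_mul_pow_le_overlap hQ hQ1' hlam0 hκ0 (fun l hl hln =>
      pow_mul_le_cyclicOverlap hQ hlam0 hlam1 hb0 hb1 hb hq0 hq1 (fun u w => hq _) hl
        (by simpa using hln)) g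
  have h2 : lam ^ n ≤ lam ^ g.support.card :=
    pow_le_pow_of_le_one hlam0 hlam1 (by simpa using Finset.card_le_univ g.support)
  have h3 := half_overlap_pixelLaw_le_errorProb hP hW Φ h0 hB hg hg1
  have h4 : lam ^ n * κ ^ Multiset.card g.cycleType ≤ overlap Q g :=
    (mul_le_mul_of_nonneg_right h2 (by positivity)).trans h1
  calc _ = 1 / 2 * (lam ^ n * κ ^ Multiset.card g.cycleType) := by ring
    _ ≤ 1 / 2 * overlap Q g := mul_le_mul_of_nonneg_left h4 (by norm_num)
    _ ≤ _ := h3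

lemma entropy_realign_le {x : Image n r} {y : Fin k → Image n r} {τ : Fin k → G}
    (h : empiricalMultiInformation (Fin.cons x y : Fin (k + 1) → Image n r) ≤
      empiricalMultiInformation (Fin.cons x (align τ y) : Fin (k + 1) → Image n r)) :
    entropy (empiricalDist (realign (withSource τ) (stack x y))) ≤
      entropy (empiricalDist (stack x y)) := by
  have h1 : ∀ y' : Fin k → Image n r,
      (fun (i : Fin n) (j : Fin (k + 1)) => (Fin.cons x y' : Fin (k + 1) → Image n r) j i) =
      stack x y' := by
    intro y'
    funext i j
    refine Fin.cases ?_ (fun j => ?_) j <;> simp [stack]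
  rw [empiricalMultiInformation, empiricalMultiInformation, h1, h1, stack_align] at h
  exact entropy_le_of_multiInformation_le (withSource τ) (stack x y) h

open Classical in
lemma IsMaxMultiInformation.errorProb_le_sum {P : Fin r → ℝ} {W : Fin r → (Fin k → Fin r) → ℝ}
    (hP : ∀ a, 0 ≤ P a) (hW : ∀ a v, 0 ≤ W a v) {Φ : Rule r k G}
    (hΦ : IsMaxMultiInformation Φ) :
    errorProb P W Φ ≤ ∑ τ ∈ Finset.univ.filter (fun τ : Fin k → G => τ ≠ 1),
      ∑ z : Fin n → Fin (k + 1) → Fin r, (∏ i, pixelLaw P W (z i)) *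
        (if entropy (empiricalDist (realign (withSource τ) z)) ≤ entropy (empiricalDist z)
          then 1 else 0) := by
  refine (hΦ.errorProb_le hP hW).trans (Finset.sum_le_sum fun τ _ => ?_)
  rw [← sum_stack]
  refine Finset.sum_le_sum fun x _ => Finset.sum_le_sum fun y _ => ?_
  rw [jointWeight_eq_prod]
  refine mul_le_mul_of_nonneg_left ?_ (Finset.prod_nonneg fun i _ => pixelLaw_nonneg hP hW _)
  split_ifs with h1 h2
  · exact le_rfl
  · exact absurd (entropy_realign_le h1) h2
  · exact zero_le_one
  · exact le_rfl

open Classical in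
/-- A maximum multiinformation rule errs with probability at most `lam ^ n`, up to the number of
alignments, a polynomial factor and an exponential factor of arbitrarily small rate `δ`. -/
lemma exists_errorProb_le (r k : ℕ) [NeZero r] {δ : ℝ} (hδ : 0 < δ) :
    ∃ ε : ℝ, 0 < ε ∧ ∃ D : ℕ, ∀ {n : ℕ} {G : Subgroup (Equiv.Perm (Fin n))}, 0 < n →
      (∀ π ∈ G, ∀ π' ∈ G, π * π' = π' * π) →
      (∀ π ∈ G, π ≠ 1 → ((Finset.univ.filter fun i => π i = i).card : ℝ) ≤ ε * n) →
      (∀ π ∈ G, π ≠ 1 → ∀ c : ℕ, 0 < c → c ≤ D → π ^ c ≠ 1) →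
      ∀ {P : Fin r → ℝ} {W : Fin r → (Fin k → Fin r) → ℝ}, (∀ a, 0 ≤ P a) → (∀ a v, 0 ≤ W a v) →
      ∀ {lam : ℝ}, 0 ≤ lam →
      (∀ B : Finset (Fin (k + 1)), 0 ∉ B → B.Nonempty → GainBound (pixelLaw P W) lam B) →
      ∀ {Φ : Rule r k G}, IsMaxMultiInformation Φ →
      errorProb P W Φ ≤ (Nat.card G : ℝ) ^ k * (lam ^ n *
        (Fintype.card (Fin (k + 1) → Fin r) : ℝ) ^ (δ * n) *
          ((n + 1 : ℝ) ^ Fintype.card (Fin (k + 1) → Fin r)) ^ 2) := by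
  obtain ⟨ε, hε, D, h⟩ := exists_increasing_class (Fin (k + 1)) hδ
  refine ⟨ε, hε, D, fun {n G} hn hcomm hfix hord {P W} hP hW {lam} hlam hgain {Φ} hΦ => ?_⟩
  refine (hΦ.errorProb_le_sum hP hW).trans ?_
  set X : ℝ := lam ^ n * (Fintype.card (Fin (k + 1) → Fin r) : ℝ) ^ (δ * n) *
          ((n + 1 : ℝ) ^ Fintype.card (Fin (k + 1) → Fin r)) ^ 2 with hX
  have hX0 : 0 ≤ X := by positivity
  have key : ∀ τ ∈ Finset.univ.filter (fun τ : Fin k → G => τ ≠ 1),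
      ∑ z : Fin n → Fin (k + 1) → Fin r, (∏ i, pixelLaw P W (z i)) *
        (if entropy (empiricalDist (realign (withSource τ) z)) ≤ entropy (empiricalDist z)
          then 1 else 0) ≤ X := by
    intro τ hτ
    have hτ1 : τ ≠ 1 := (Finset.mem_filter.mp hτ).2
    let _ : CommGroup G := { (inferInstance : Group G) with
      mul_comm := fun a b => Subtype.ext (hcomm a a.2 b b.2) }
    let ρ : Fin (k + 1) → G := Fin.cons 1 fun j => (τ j)⁻¹
    have hρ1 : ρ ≠ 1 := by
      intro h'
      refine hτ1 (funext fun j => ?_)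
      have := congrFun h' j.succ
      simpa [ρ] using this
    have hρτ : ∀ j, (withSource τ)⁻¹ j = (ρ j : Equiv.Perm (Fin n)) := by
      intro j
      refine Fin.cases ?_ (fun j => ?_) j <;> simp [withSource, ρ]
    obtain ⟨b, hb, t, ht⟩ := h (H := G) (X := Fin n)
      (fun g hg => by
        rw [Fintype.card_fin]
        convert hfix g g.2 fun h' => hg (Subtype.ext h')
        rfl)
      (fun g hg c hc hcD hgc => hord g g.2 (fun h' => hg (Subtype.ext h')) c hc hcD
        (congrArg Subtype.val hgc)) ρ ⟨0, rfl⟩ hρ1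
    have hB0 : (0 : Fin (k + 1)) ∉ Finset.univ.filter fun j => ρ j = ρ b := by
      intro h'
      exact hb ((Finset.mem_filter.mp h').2.symm)
    have hBne : (Finset.univ.filter fun j => ρ j = ρ b).Nonempty :=
      ⟨b, Finset.mem_filter.mpr ⟨Finset.mem_univ _, rfl⟩⟩
    refine (sum_confused_le hn (pixelLaw_nonneg hP hW) hlam (hgain _ hB0 hBne) (withSource τ) b
      (fun j => ?_) t).trans ?_
    · rw [hρτ, hρτ, Finset.mem_filter_univ, Subtype.coe_inj]
    · refine mul_le_mul_of_nonneg_right (mul_le_mul_of_nonneg_left ?_ (by positivity))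
        (by positivity)
      have hc : (1 : ℝ) ≤ (Fintype.card (Fin (k + 1) → Fin r) : ℝ) := by
        exact_mod_cast Fintype.card_pos
      rw [← Real.rpow_natCast]
      refine Real.rpow_le_rpow_of_exponent_le hc ?_
      rw [Fintype.card_fin] at ht
      refine le_trans (le_of_eq ?_) ht
      congr 2
      ext i
      simp only [Finset.mem_filter, Finset.mem_univ, true_and, hρτ, ne_eq, Subtype.coe_inj]
      rfl
  calc _ ≤ ∑ τ ∈ Finset.univ.filter (fun τ : Fin k → G => τ ≠ 1), X := Finset.sum_le_sum key
    _ ≤ ∑ τ : Fin k → G, X :=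
        Finset.sum_le_sum_of_subset_of_nonneg (Finset.subset_univ _) fun _ _ _ => hX0
    _ = _ := by rw [Finset.sum_const, Finset.card_univ, nsmul_eq_mul, card_pi_subgroup]

end Rules

/-! ### Asymptotics -/

lemma isErrorExponent_of_forall {Pe : ℕ → ℝ} {E : ℝ}
    (hl : ∀ ε : ℝ, 0 < ε → ∀ᶠ n : ℕ in atTop, Real.exp (-((E + ε) * n)) ≤ Pe n)
    (hu : ∀ ε : ℝ, 0 < ε → ∀ᶠ n : ℕ in atTop, Pe n ≤ Real.exp (-((E - ε) * n))) :
    IsErrorExponent Pe E := by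
  refine ⟨(hl 1 one_pos).mono fun n hn => (Real.exp_pos _).trans_le hn, ?_⟩
  rw [Metric.tendsto_atTop']
  intro ε hε
  obtain ⟨N, hN⟩ := eventually_atTop.mp ((hl (ε / 2) (half_pos hε)).and (hu (ε / 2) (half_pos hε)))
  refine ⟨N, fun n hn => ?_⟩
  obtain ⟨h1, h2⟩ := hN n hn.le
  have hn0 : (0 : ℝ) < n := by exact_mod_cast (Nat.zero_le N).trans_lt hn
  have hpos : 0 < Pe n := (Real.exp_pos _).trans_le h1
  have h3 := (Real.le_log_iff_exp_le hpos).mpr h1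
  have h4 := (Real.log_le_iff_le_exp hpos).mpr h2
  rw [Real.dist_eq, abs_lt]
  have h5 : -(1 / (n : ℝ)) * Real.log (Pe n) = (-Real.log (Pe n)) / n := by ring
  rw [h5]
  constructor
  · have : E - ε / 2 ≤ -Real.log (Pe n) / n := by rw [le_div_iff₀ hn0]; linarith
    linarith
  · have : -Real.log (Pe n) / n ≤ E + ε / 2 := by rw [div_le_iff₀ hn0]; linarith
    linarith

section Asymptotics

variable {G : ∀ n : ℕ, Subgroup (Equiv.Perm (Fin n))}

/-- The number of alignments and all polynomial factors are subexponential. -/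
lemma Admissible.card_pow_mul_le_exp (hG : Admissible G) (k D : ℕ) {ε : ℝ} (hε : 0 < ε) :
    ∀ᶠ n : ℕ in atTop,
      (Nat.card (G n) : ℝ) ^ k * ((n + 1 : ℝ) ^ D) ^ 2 ≤ Real.exp (ε * n) := by
  obtain ⟨α, hα⟩ := hG.card_le
  set ε' : ℝ := ε / (k + 4 * D + 1) with hε'
  have hε'0 : 0 < ε' := by positivity
  have h1 : (fun n : ℕ => (Nat.card (G n) : ℝ)) =o[atTop] fun n : ℕ => Real.exp (ε' * n) :=
    hα.trans_isLittleO
      ((isLittleO_rpow_exp_pos_mul_atTop α hε'0).comp_tendsto tendsto_natCast_atTop_atTop)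
  have h2 : (fun n : ℕ => (n : ℝ) ^ 1) =o[atTop] fun n : ℕ => Real.exp (ε' * n) :=
    (isLittleO_pow_exp_pos_mul_atTop 1 hε'0).comp_tendsto tendsto_natCast_atTop_atTop
  filter_upwards [h1.bound one_pos, h2.bound one_pos, eventually_ge_atTop 2] with n hn1 hn2 hn
  rw [one_mul, Real.norm_of_nonneg (Nat.cast_nonneg _), Real.norm_of_nonneg (Real.exp_pos _).le]
    at hn1
  rw [one_mul, pow_one, Real.norm_of_nonneg (Nat.cast_nonneg _),
    Real.norm_of_nonneg (Real.exp_pos _).le] at hn2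
  have hn' : (2 : ℝ) ≤ n := by exact_mod_cast hn
  have h3 : (n + 1 : ℝ) ≤ Real.exp (ε' * n) ^ 2 := by
    calc (n + 1 : ℝ) ≤ (n : ℝ) ^ 2 := by nlinarith
      _ ≤ _ := pow_le_pow_left₀ (by positivity) hn2 2
  calc (Nat.card (G n) : ℝ) ^ k * ((n + 1 : ℝ) ^ D) ^ 2
      ≤ Real.exp (ε' * n) ^ k * ((Real.exp (ε' * n) ^ 2) ^ D) ^ 2 := by gcongr
    _ = Real.exp (((k + 4 * D : ℝ) * ε') * n) := by
        rw [← pow_mul, ← pow_mul, ← pow_add, ← Real.exp_nat_mul]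
        congr 1
        push_cast
        ring
    _ ≤ Real.exp (ε * n) := by
        refine Real.exp_le_exp.mpr (mul_le_mul_of_nonneg_right ?_ (by positivity))
        rw [hε', mul_div_assoc', div_le_iff₀ (by positivity)]
        nlinarith

/-- Nontrivial elements have few cycles, so a polynomially small factor for each cycle is
subexponential. -/
lemma Admissible.exp_le_half_mul_pow (hG : Admissible G) (D : ℕ) {C q : ℝ} (hC : 0 < C)
    (hq : 0 < q) {ε : ℝ} (hε : 0 < ε) :
    ∀ᶠ n : ℕ in atTop, ∃ g ∈ G n, g ≠ 1 ∧ Real.exp (-(ε * n)) ≤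
      1 / 2 * (q / (C * ((n + 1 : ℝ) ^ D) ^ 2)) ^ Multiset.card g.cycleType := by
  set L : ℝ := 4 * D + 1 with hL
  have hL0 : 0 < L := by positivity
  filter_upwards [hG.nontrivial, hG.cycles (ε / (2 * L)) (by positivity), eventually_ge_atTop 3,
    tendsto_natCast_atTop_atTop.eventually_ge_atTop (C / q),
    tendsto_natCast_atTop_atTop.eventually_ge_atTop (2 * Real.log 2 / ε)]
    with n hnt hcyc hn hCn h2n
  obtain ⟨g, hg, hg1⟩ := hnt
  refine ⟨g, hg, hg1, ?_⟩
  have hc := hcyc g hg hg1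
  set c := Multiset.card g.cycleType
  have hn3 : (3 : ℝ) ≤ n := by exact_mod_cast hn
  have hlog : 0 < Real.log n := Real.log_pos (by linarith)
  have h1 : C * ((n + 1 : ℝ) ^ D) ^ 2 / q ≤ (n : ℝ) ^ (4 * D + 1) := by
    calc C * ((n + 1 : ℝ) ^ D) ^ 2 / q = ((n + 1 : ℝ) ^ D) ^ 2 * (C / q) := by ring
      _ ≤ (((n : ℝ) ^ 2) ^ D) ^ 2 * n := by
          have : (n + 1 : ℝ) ≤ (n : ℝ) ^ 2 := by nlinarith
          gcongr
      _ = _ := by rw [← pow_mul, ← pow_mul, ← pow_succ]; congr 1; ring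
  have h2 : Real.exp (-(L * Real.log n)) ≤ q / (C * ((n + 1 : ℝ) ^ D) ^ 2) := by
    have : Real.exp (L * Real.log n) = (n : ℝ) ^ (4 * D + 1) := by
      rw [hL, ← Real.rpow_natCast, Real.rpow_def_of_pos (by linarith)]
      congr 1
      push_cast
      ring
    rw [Real.exp_neg, this, ← inv_div]
    exact inv_anti₀ (by positivity) h1
  have h3 : Real.exp (-(ε / 2 * n)) ≤ (q / (C * ((n + 1 : ℝ) ^ D) ^ 2)) ^ c := by
    refine le_trans ?_ (pow_le_pow_left₀ (Real.exp_pos _).le h2 c)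
    rw [← Real.exp_nat_mul, Real.exp_le_exp]
    have : (c : ℝ) * (L * Real.log n) ≤ ε / 2 * n := by
      calc (c : ℝ) * (L * Real.log n) ≤ (ε / (2 * L) * (n / Real.log n)) * (L * Real.log n) :=
            mul_le_mul_of_nonneg_right hc (by positivity)
        _ = _ := by field_simp
    linarith
  have h4 : Real.exp (-(ε / 2 * n)) ≤ 1 / 2 := by
    rw [div_le_iff₀ hε] at h2n
    rw [← Real.le_log_iff_exp_le (by norm_num), one_div, Real.log_inv]
    linarith
  calc Real.exp (-(ε * n)) = Real.exp (-(ε / 2 * n)) * Real.exp (-(ε / 2 * n)) := by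
        rw [← Real.exp_add]; congr 1; ring
    _ ≤ _ := mul_le_mul h4 h3 (Real.exp_pos _).le (by norm_num)

/-- Nontrivial elements do not have small order: otherwise all their cycles would be short, and
there would be too many of them. -/
lemma Admissible.pow_ne_one (hG : Admissible G) (D : ℕ) :
    ∀ᶠ n : ℕ in atTop, ∀ π ∈ G n, π ≠ 1 → ∀ c : ℕ, 0 < c → c ≤ D → π ^ c ≠ 1 := by
  filter_upwards [hG.cycles (1 / (4 * (D + 1))) (by positivity), hG.fixed (1 / 4) (by norm_num),
    eventually_ge_atTop 3] with n hcyc hfix hn π hπ hπ1 c hc hcD hpow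
  have h1 := hcyc π hπ hπ1
  have h2 := hfix π hπ hπ1
  have hn3 : (3 : ℝ) ≤ n := by exact_mod_cast hn
  have hlog : 1 ≤ Real.log n := by
    rw [Real.le_log_iff_exp_le (by linarith)]
    have := Real.exp_one_lt_d9
    linarith
  -- all cycle lengths divide `c`
  have h3 : π.support.card ≤ Multiset.card π.cycleType * D := by
    rw [← Equiv.Perm.sum_cycleType, ← smul_eq_mul]
    refine Multiset.sum_le_card_nsmul _ _ fun l hl => ?_
    exact (Nat.le_of_dvd hc ((Equiv.Perm.dvd_of_mem_cycleType hl).trans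
      (orderOf_dvd_of_pow_eq_one hpow))).trans hcD
  have h4 : (Finset.univ.filter fun i => π i = i).card + π.support.card = n := by
    have := Finset.card_filter_add_card_filter_not (s := (Finset.univ : Finset (Fin n)))
      (fun i => π i = i)
    rw [Finset.card_univ, Fintype.card_fin] at this
    exact this
  have h5 : ((Finset.univ.filter fun i => π i = i).card : ℝ) + π.support.card = n := by
    exact_mod_cast h4
  have h6 : (π.support.card : ℝ) ≤ Multiset.card π.cycleType * D := by exact_mod_cast h3
  have h7 : (n : ℝ) / Real.log n ≤ n := div_le_self (by positivity) hlog
  have h8 : (Multiset.card π.cycleType : ℝ) * D ≤ 1 / 4 * n := by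
    calc (Multiset.card π.cycleType : ℝ) * D
        ≤ (1 / (4 * (D + 1)) * (n / Real.log n)) * (D + 1) := by gcongr; linarith
      _ = 1 / 4 * (n / Real.log n) := by field_simp
      _ ≤ _ := by linarith
  linarith

end Asymptotics

section Exponent

variable {G : ∀ n : ℕ, Subgroup (Equiv.Perm (Fin n))} {r k : ℕ}

/-- The base `lam` of the error probability: the largest value of the squared top singular value
of `√Q` over the ways to split the components in two classes.  It bounds the errors of maximum
multiinformation rules from above and those of all rules from below. -/
lemma exists_optimal_base (hk : 1 ≤ k) (hG : Admissible G) {P : Fin r → ℝ}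
    {W : Fin r → (Fin k → Fin r) → ℝ} (hP : P ∈ stdSimplex ℝ (Fin r))
    (hW : ∀ a, W a ∈ stdSimplex ℝ (Fin k → Fin r)) :
    ∃ lam : ℝ, 0 < lam ∧
      (∀ B : Finset (Fin (k + 1)), 0 ∉ B → B.Nonempty → GainBound (pixelLaw P W) lam B) ∧
      ∀ Ψ : (∀ n : ℕ, Rule r k (G n)), ∀ ε : ℝ, 0 < ε → ∀ᶠ n : ℕ in atTop,
        lam ^ n * Real.exp (-(ε * n)) ≤ errorProb P W (Ψ n) := by
  have hr : NeZero r := ⟨by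
    rintro rfl
    simpa using hP.2⟩
  have hQ0 : ∀ a, 0 ≤ pixelLaw P W a := pixelLaw_nonneg hP.1 fun a => (hW a).1
  have hQ1 : ∑ a, pixelLaw P W a = 1 := sum_pixelLaw hP.2 fun a => (hW a).2
  have hsing : ∀ B : Finset (Fin (k + 1)), ∃ lam : ℝ, 0 ≤ lam ∧ GainBound (pixelLaw P W) lam B ∧
      ∃ b : ({j // j ∈ B} → Fin r) → ℝ, (∀ w, 0 ≤ b w) ∧ ∑ w, b w ^ 2 = 1 ∧
        ∀ w, ∑ u, √(pixelLaw P W (merge B w u)) *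
          ∑ w', √(pixelLaw P W (merge B w' u)) * b w' = lam * b w := fun B =>
    exists_top_singular (fun u w => √(pixelLaw P W (merge B w u))) fun _ _ => Real.sqrt_nonneg _
  choose lam hlam0 hgain hb using hsing
  have hne : (Finset.univ.filter fun B : Finset (Fin (k + 1)) => 0 ∉ B ∧ B.Nonempty).Nonempty := by
    refine ⟨{Fin.last k}, ?_⟩
    have : (0 : Fin (k + 1)) ≠ Fin.last k := by
      rw [Ne, Fin.ext_iff, Fin.val_zero, Fin.val_last]
      omega
    simpa using this
  obtain ⟨B, hB, hmax⟩ := Finset.exists_max_image _ lam hne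
  obtain ⟨hB0, hBne⟩ := (Finset.mem_filter.mp hB).2
  have hpos : 0 < lam B := (hgain B).pos hQ1
  refine ⟨lam B, hpos, fun B' h0 h1 => (hgain B').mono
    (hmax B' (Finset.mem_filter.mpr ⟨Finset.mem_univ _, h0, h1⟩)), fun Ψ ε hε => ?_⟩
  obtain ⟨b, hb0, hb1, hbe⟩ := hb B
  obtain ⟨q, hq0, hq1, hq⟩ := exists_pos_lower_bound hQ0 hQ1
  have hC : (1 : ℝ) ≤ (Fintype.card ({j // j ∈ B} → Fin r) : ℝ) ^ 2 :=
    one_le_pow₀ (by exact_mod_cast Fintype.card_pos)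
  filter_upwards [hG.exp_le_half_mul_pow
    (Fintype.card (({j // j ∉ B} → Fin r) × ({j // j ∈ B} → Fin r))) (one_pos.trans_le hC) hq0
    hε] with n hn
  obtain ⟨g, hg, hg1, hexp⟩ := hn
  exact (mul_le_mul_of_nonneg_left hexp (by positivity)).trans
    (pow_mul_pow_le_errorProb hP.1 (fun a => (hW a).1) hQ1 (Ψ n) hB0 hBne hg hg1 hpos.le hb0 hb1
      hbe hq0.le hq1 hq)

/-- Maximum multiinformation rules attain the exponent `-log lam`. -/
lemma errorProb_maxMultiInformation_le (hG : Admissible G) {P : Fin r → ℝ}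
    {W : Fin r → (Fin k → Fin r) → ℝ} (hP : P ∈ stdSimplex ℝ (Fin r))
    (hW : ∀ a, W a ∈ stdSimplex ℝ (Fin k → Fin r)) {lam : ℝ} (hlam : 0 ≤ lam)
    (hgain : ∀ B : Finset (Fin (k + 1)), 0 ∉ B → B.Nonempty → GainBound (pixelLaw P W) lam B)
    {Φ : ∀ n : ℕ, Rule r k (G n)} (hΦ : ∀ n, IsMaxMultiInformation (Φ n)) {ε : ℝ} (hε : 0 < ε) :
    ∀ᶠ n : ℕ in atTop, errorProb P W (Φ n) ≤ lam ^ n * Real.exp (ε * n) := by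
  have hr : NeZero r := ⟨by
    rintro rfl
    simpa using hP.2⟩
  set c : ℝ := ((Fintype.card (Fin (k + 1) → Fin r) : ℕ) : ℝ) with hc
  have hc1 : 1 ≤ c := by
    rw [hc]
    exact_mod_cast Fintype.card_pos
  have hlogc : 0 ≤ Real.log c := Real.log_nonneg hc1
  have hδ : 0 < ε / (2 * (Real.log c + 1)) := by positivity
  obtain ⟨ε', hε', D, h⟩ := exists_errorProb_le r k hδ
  filter_upwards [hG.fixed ε' hε', hG.pow_ne_one D, hG.card_pow_mul_le_exp k
    (Fintype.card (Fin (k + 1) → Fin r)) (half_pos hε), eventually_gt_atTop 0]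
    with n hfix hord hcard hn
  refine (h hn (hG.comm n) hfix hord hP.1 (fun a => (hW a).1) hlam hgain (hΦ n)).trans ?_
  have h1 : c ^ (ε / (2 * (Real.log c + 1)) * n) ≤ Real.exp (ε / 2 * n) := by
    rw [Real.rpow_def_of_pos (one_pos.trans_le hc1), Real.exp_le_exp, ← mul_assoc]
    refine mul_le_mul_of_nonneg_right ?_ (Nat.cast_nonneg n)
    rw [mul_div_assoc', div_le_div_iff₀ (by positivity) two_pos]
    nlinarith
  calc _ = lam ^ n * (c ^ (ε / (2 * (Real.log c + 1)) * n) *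
        ((Nat.card (G n) : ℝ) ^ k *
          ((n + 1 : ℝ) ^ Fintype.card (Fin (k + 1) → Fin r)) ^ 2)) := by ring
    _ ≤ lam ^ n * (Real.exp (ε / 2 * n) * Real.exp (ε / 2 * n)) :=
        mul_le_mul_of_nonneg_left (mul_le_mul h1 hcard (by positivity) (Real.exp_pos _).le)
          (by positivity)
    _ = _ := by
        rw [← Real.exp_add]
        congr 2
        ring

end Exponent

end ImageRegistration

theorem mainTheorem2 (r k : ℕ) (hk : 1 ≤ k)
    (G : ∀ n : ℕ, Subgroup (Equiv.Perm (Fin n))) (hG : ImageRegistration.Admissible G)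
    (ΦMM : ∀ n : ℕ, ImageRegistration.Rule r k (G n))
    (hMM : ∀ n, ImageRegistration.IsMaxMultiInformation (ΦMM n)) :
    ∀ P : Fin r → ℝ, P ∈ stdSimplex ℝ (Fin r) →
    ∀ W : Fin r → (Fin k → Fin r) → ℝ, (∀ a, W a ∈ stdSimplex ℝ (Fin k → Fin r)) →
    ∀ ΦML : (∀ n : ℕ, ImageRegistration.Rule r k (G n)),
      (∀ n, ImageRegistration.IsMaxLikelihood W (ΦML n)) →
      ∃ E : ℝ,
        ImageRegistration.IsErrorExponent
          (fun n => ImageRegistration.errorProb P W (ΦMM n)) E ∧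
        ImageRegistration.IsErrorExponent
          (fun n => ImageRegistration.errorProb P W (ΦML n)) E ∧
        ∀ Ψ : (∀ n : ℕ, ImageRegistration.Rule r k (G n)), ∀ ε : ℝ, 0 < ε →
          ∀ᶠ n : ℕ in atTop,
            Real.exp (-((E + ε) * (n : ℝ))) ≤ ImageRegistration.errorProb P W (Ψ n) := by
  intro P hP W hW ΦML hML
  obtain ⟨lam, hlam, hgain, hlow⟩ := ImageRegistration.exists_optimal_base hk hG hP hW
  have hpow : ∀ n : ℕ, lam ^ n = Real.exp (n * Real.log lam) := fun n => by
    rw [Real.exp_nat_mul, Real.exp_log hlam]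
  have hlower : ∀ Ψ : (∀ n : ℕ, ImageRegistration.Rule r k (G n)), ∀ ε : ℝ, 0 < ε →
      ∀ᶠ n : ℕ in atTop, Real.exp (-((-Real.log lam + ε) * (n : ℝ))) ≤
        ImageRegistration.errorProb P W (Ψ n) := by
    intro Ψ ε hε
    filter_upwards [hlow Ψ ε hε] with n hn
    refine le_trans (le_of_eq ?_) hn
    rw [hpow, ← Real.exp_add]
    congr 1
    ring
  have hupper : ∀ ε : ℝ, 0 < ε → ∀ᶠ n : ℕ in atTop,
      ImageRegistration.errorProb P W (ΦMM n) ≤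
        Real.exp (-((-Real.log lam - ε) * (n : ℝ))) := by
    intro ε hε
    filter_upwards [ImageRegistration.errorProb_maxMultiInformation_le hG hP hW hlam.le hgain hMM
      hε] with n hn
    refine hn.trans (le_of_eq ?_)
    rw [hpow, ← Real.exp_add]
    congr 1
    ring
  refine ⟨-Real.log lam, ImageRegistration.isErrorExponent_of_forall (hlower ΦMM) hupper,
    ImageRegistration.isErrorExponent_of_forall (hlower ΦML) fun ε hε => ?_, hlower⟩
  filter_upwards [hupper ε hε] with n hn
  exact ((hML n).errorProb_le hP.1 (ΦMM n)).trans hn
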